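/- Let $S\subset\mathbb R^2$ be a compact convex set with non-empty interior whose boundary $\partial S$ is of class $C^3$, parametrized by arc length by a simple closed $C^3$ curve $\gamma$. The visibility domain $V_S$ is the set of pairs $(p,v)$ with $p\in\mathbb R^2\setminus\operatorname{int}S$ and $v$ a unit vector such that the ray $\{p+tv:t\ge 0\}$ meets $S$. The bouncing outer billiard map $F_S(p,v)=(p',v')$ is defined as follows. Let $w$ be the first point of $S$ on the ray. Reflect the ray at $w$ off $\partial S$ (angle of incidence equals angle of reflection), and let $p'$ be the point of the reflected ray with $\|p'-w\|=\|p-w\|$. Let $u$ be the unit vector at $p'$ opposite to the direction of the reflected ray (so it points to $w$), and let $v'$ be the mirror image of $u$ in the bisector of the angle formed by the two rays from $p'$ tangent to $S$. A point $x\in\partial S$ is a vertex if the curvature of $\partial S$ has a local minimum or a local maximum (not necessarily strict) at $x$. Let $I_x\subset\partial S$ be the largest line segment in $\partial S$ containing $x$; thus $I_x=\{x\}$ unless $x$ lies on a straight piece of the boundary. For $\varepsilon>0$, a local 1-parameter family of fixed points in the $\varepsilon$-neighbourhood of $I_x$ is a connected set $C\subset V_S$ of fixed points $(p,v)$ of $F_S$,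 with $p\notin S$ and $\operatorname{dist}(p,I_x)<\varepsilon$, for which there is $\delta>0$ such that for every $t\in(0,\delta)$ some $(p,v)\in C$ has $\operatorname{dist}(p,S)=t$. Theorem 2.1. (1) $F_S$ has uncountably many fixed points $(p,v)$ with $p\notin S$. (2) For every vertex $x$ of $\partial S$ and every $\varepsilon>0$ there is a local 1-parameter family of fixed points in the $\varepsilon$-neighbourhood of $I_x$. (3) There are four vertices $x_1,\dots,x_4$ of $\partial S$ with $I_{x_1},\dots,I_{x_4}$ pairwise disjoint; and for every $\varepsilon>0$ there are pairwise disjoint local 1-parameter families $C_1,\dots,C_4$ of fixed points with $C_i$ in the $\varepsilon$-neighbourhood of $I_{x_i}$. -/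

import Mathlib

open Set Metric
open scoped RealInnerProductSpace

noncomputable section

/-- The Euclidean plane. -/
abbrev Plane : Type := EuclideanSpace ℝ (Fin 2)

/-! ### The bouncing outer billiard map of a planar convex body `S` -/

/-- The mirror image of the vector `x` in the line through the origin orthogonal to `n ≠ 0`. -/
def mirror (n x : Plane) : Plane := (ℝ ∙ n)ᗮ.reflection x

/-- The visibility domain `V_S`: pairs `(p, v)` where `p` is not an interior point of `S` and `v` is
a unit vector at `p` whose ray meets `S`. -/
def visibilityDomain (S : Set Plane) : Set (Plane × Plane) :=
  {z | z.1 ∉ interior S ∧ ‖z.2‖ = 1 ∧ ∃ t : ℝ, 0 ≤ t ∧ z.1 + t • z.2 ∈ S}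

/-- The length travelled along the ray of `(p, v)` until `S` is hit for the first time. -/
def hitTime (S : Set Plane) (z : Plane × Plane) : ℝ :=
  sInf {t : ℝ | 0 ≤ t ∧ z.1 + t • z.2 ∈ S}

/-- The bounce point `w`. -/
def bouncePoint (S : Set Plane) (z : Plane × Plane) : Plane :=
  z.1 + hitTime S z • z.2

/-- `ν` is an outward unit normal of `S` at `w`. -/
def IsOuterNormal (S : Set Plane) (w ν : Plane) : Prop :=
  ‖ν‖ = 1 ∧ ∀ y ∈ S, ⟪y - w, ν⟫ ≤ 0

/-- The outward unit normal at a boundary point (unique when `S` is a convex body with `C¹`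
boundary). -/
def outerNormal (S : Set Plane) (w : Plane) : Plane :=
  Classical.epsilon (IsOuterNormal S w)

/-- The unit direction of the ray reflected at the bounce point (angle of incidence = angle of
reflection): the mirror image of `v` in the tangent line of `∂S` at `w`. -/
def bouncedDirection (S : Set Plane) (z : Plane × Plane) : Plane :=
  mirror (outerNormal S (bouncePoint S z)) z.2

/-- The point `p'` on the reflected ray with `‖p' - w‖ = ‖p - w‖`. -/
def newPoint (S : Set Plane) (z : Plane × Plane) : Plane :=
  bouncePoint S z + hitTime S z • bouncedDirection S z

/-- The ray from `p` in the unit direction `d` is tangent to `S`: it meets `S`, and the line that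
carries it is a supporting line of `S`. From a point outside a convex body there are exactly two
such rays. -/
def IsTangentDirection (S : Set Plane) (p d : Plane) : Prop :=
  ‖d‖ = 1 ∧ (∃ t : ℝ, 0 ≤ t ∧ p + t • d ∈ S) ∧
    ∃ ν : Plane, ‖ν‖ = 1 ∧ ⟪d, ν⟫ = 0 ∧ ∀ y ∈ S, ⟪y - p, ν⟫ ≤ 0

/-- The unit directions of the two tangent rays from `p` to `S`, in some order. -/
def tangentDirections (S : Set Plane) (p : Plane) : Plane × Plane :=
  Classical.epsilon fun d : Plane × Plane =>
    d.1 ≠ d.2 ∧ IsTangentDirection S p d.1 ∧ IsTangentDirection S p d.2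

/-- Reflection of vectors at `p` across the bisector of the angle between the two tangent rays from
`p` to `S`. For distinct unit vectors `d₁`, `d₂` of the plane, the line orthogonal to `d₁ - d₂` is
the bisector of the angle they form, so the order of the two directions is irrelevant. -/
def bisectorReflection (S : Set Plane) (p u : Plane) : Plane :=
  mirror ((tangentDirections S p).1 - (tangentDirections S p).2) u

/-- The bouncing outer billiard map `F_S (p, v) = (p', v')`. The unit vector `u` at `p'` that points
to `w` is opposite to the direction of the reflected ray, and `v'` is the mirror image of `u` across
the bisector of the angle under which `S` is seen from `p'`. -/
def bouncingOuterBilliard (S : Set Plane) (z : Plane × Plane) : Plane × Plane :=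
  (newPoint S z, bisectorReflection S (newPoint S z) (-bouncedDirection S z))

/-- The fixed points `(p, v)` of `F_S` whose base point `p` is outside `S`. (Over `∂S` the map is the
identity, so the fixed points there are of no interest.) -/
def exteriorFixedPoints (S : Set Plane) : Set (Plane × Plane) :=
  {z | z ∈ visibilityDomain S ∧ z.1 ∉ S ∧ bouncingOuterBilliard S z = z}

/-! ### `C³` boundary, curvature, vertices -/

/-- `γ` is an arc-length parametrization of class `C³` of `∂S`, which is a simple closed curve of
length `L`. -/
structure IsArcLengthBoundary (S : Set Plane) (L : ℝ) (γ : ℝ → Plane) : Prop where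
  length_pos : 0 < L
  contDiff : ContDiff ℝ 3 γ
  unit_speed : ∀ s, ‖deriv γ s‖ = 1
  periodic : Function.Periodic γ L
  injOn : InjOn γ (Ico 0 L)
  range_eq : range γ = frontier S

/-- The curvature at `γ s` of a curve `γ` parametrized by arc length. (The boundary of a convex body
always turns the same way, so no sign is needed.) -/
def curvature (γ : ℝ → Plane) (s : ℝ) : ℝ := ‖deriv (deriv γ) s‖

/-- `γ s` is a vertex: the curvature has a local minimum or a local maximum there. -/
def IsVertex (γ : ℝ → Plane) (s : ℝ) : Prop := IsLocalExtr (curvature γ) s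

/-- The maximal line segment in `∂S` through the boundary point `x`. It is `{x}` unless `x` lies on a
straight piece of the boundary; in particular it is `{x}` when the curvature at `x` is positive. -/
def flatPiece (S : Set Plane) (x : Plane) : Set Plane :=
  {y | segment ℝ x y ⊆ frontier S}

/-- `C` is a local one-parameter family of fixed points of `F_S` inside the region `U`: a connected
set of fixed points `(p, v)` with `p ∈ U \ S`, in which the distance from `p` to `S` runs through
all sufficiently small positive values. -/
def IsLocalFixedFamily (S U : Set Plane) (C : Set (Plane × Plane)) : Prop :=
  C ⊆ exteriorFixedPoints S ∧ (∀ z ∈ C, z.1 ∈ U) ∧ IsConnected C ∧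
    ∃ δ : ℝ, 0 < δ ∧ ∀ t ∈ Ioo 0 δ, ∃ z ∈ C, infDist z.1 S = t

end

noncomputable section

/-! From `γ s + t • ν s`, the ray in direction `-ν s` meets the boundary perpendicularly at `γ s`
and returns along itself. The pair is therefore fixed as soon as the normal bisects the angle of the
two tangent rays. In the frame `T s`, `-ν s` the slopes of these rays are maxima over `S`
(`upperSlope` for `T s` and for `-T s`), so it suffices that the two maxima agree
(`ContactFrame.mem_exteriorFixedPoints`). The problem becomes the zero set of one continuous
function `g (s, t)` on `t > 0`, the difference of the two slopes.

For small `t` the sign of `g (s, t)` is dictated by `κ'` wherever `κ s ≠ 0` and `κ' s ≠ 0`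
(`upperSlope_lt`, `upperSlope_gt`). The maximal slope is attained at a small arc length `u ≥ t`
(`exists_slope_eq_near`). If `κ' > 0`, the third order expansion shows the boundary point at `s - u`
less deep than the one at `s + u`, by an amount of order `u ^ 3`, while their tangential distances
agree up to `o(u ^ 3)`.

At a vertex the curvature leaves its extremal value on both sides in the same sense. Hence there are
`a < b` close to it with `κ'` of opposite signs, and `g` has opposite signs on the vertical edges of
`[a, b] × (0, δ]`. A separation argument based on the Poincaré–Miranda theorem yields a connected
set of zeros meeting every level (`exists_connected_zeros_crossing`). If the vertex has zero
curvature, the rectangle spans its whole flat arc, whence the neighbourhood of the flat piece. If an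
arc nearby has constant nonzero curvature, it is circular and a single normal segment serves as the
family.

Four vertices come from `not_monotone_antitone`: if `κ` increased from `p` to `q` and decreased
back, then `κ' f ≤ 0` for the signed distance `f` to the chord, yet `κ' f` has a periodic
antiderivative. Two alternating vertices are maxima of positive curvature, and a supporting line
touching at two points forces one of the arcs between them to be flat (`flat_of_common_support`), so
the four flat pieces are disjoint. -/

/-! ### A crossing lemma for rectangles -/

/-- A continuous angle that stays in the right half-plane and moves from the lower to the upper
half-plane increases. -/
lemma angle_lt_of_cos_pos {φ : ℝ → ℝ} {x y : ℝ} (hφ : ContinuousOn φ (uIcc x y))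
    (hcos : ∀ t ∈ uIcc x y, 0 < Real.cos (φ t)) (hx : Real.sin (φ x) < 0)
    (hy : 0 < Real.sin (φ y)) : φ x < φ y := by
  by_contra! hle
  have hpos : ∀ r ∈ Icc (φ y) (φ x), 0 < Real.cos r := by
    intro r hr
    obtain ⟨t, ht, rfl⟩ := intermediate_value_uIcc hφ (Icc_subset_uIcc' hr)
    exact hcos t ht
  have hmono : MonotoneOn Real.sin (Icc (φ y) (φ x)) := by
    refine monotoneOn_of_deriv_nonneg (convex_Icc _ _) Real.continuous_sin.continuousOn
      Real.differentiable_sin.differentiableOn fun r hr => ?_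
    rw [Real.deriv_sin]
    exact (hpos r (interior_subset hr)).le
  have := hmono (left_mem_Icc.2 hle) (right_mem_Icc.2 hle) hle
  linarith

/-- The two-dimensional Poincaré–Miranda theorem. -/
theorem exists_common_zero_rectangle {a b c d : ℝ} (hab : a ≤ b) (hcd : c ≤ d) {g h : ℝ × ℝ → ℝ}
    (hg : ContinuousOn g (Icc a b ×ˢ Icc c d)) (hh : ContinuousOn h (Icc a b ×ˢ Icc c d))
    (ga : ∀ t ∈ Icc c d, g (a, t) < 0) (gb : ∀ t ∈ Icc c d, 0 < g (b, t))
    (hc : ∀ s ∈ Icc a b, h (s, c) < 0) (hd : ∀ s ∈ Icc a b, 0 < h (s, d)) :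
    ∃ z ∈ Icc a b ×ˢ Icc c d, g z = 0 ∧ h z = 0 := by
  by_contra! hne
  -- Composing with the retraction onto the rectangle extends `g + i h` without zeros to the whole
  -- plane. That is open and simply connected, so a continuous logarithm exists.
  set cl : ℝ × ℝ → ℝ × ℝ := fun z => (projIcc a b hab z.1, projIcc c d hcd z.2) with hcl
  have hclc : Continuous cl := by
    refine Continuous.prodMk ?_ ?_
    · exact continuous_subtype_val.comp (continuous_projIcc.comp continuous_fst)
    · exact continuous_subtype_val.comp (continuous_projIcc.comp continuous_snd)
  have hclm : ∀ z, cl z ∈ Icc a b ×ˢ Icc c d := fun z =>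
    ⟨(projIcc a b hab z.1).2, (projIcc c d hcd z.2).2⟩
  have hcli : ∀ s ∈ Icc a b, ∀ t ∈ Icc c d, cl (s, t) = (s, t) := by
    intro s hs t ht
    simp [hcl, projIcc_of_mem hab hs, projIcc_of_mem hcd ht]
  have hgc : Continuous fun z => g (cl z) := hg.comp_continuous hclc hclm
  have hhc : Continuous fun z => h (cl z) := hh.comp_continuous hclc hclm
  set G : ℝ × ℝ → ℂ := fun z => (g (cl z) : ℂ) + (h (cl z) : ℂ) * Complex.I with hG
  have hGc : Continuous G :=
    (Complex.continuous_ofReal.comp hgc).add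
      ((Complex.continuous_ofReal.comp hhc).mul continuous_const)
  have hG0 : (0 : ℂ) ∉ G '' univ := by
    rintro ⟨z, -, hz⟩
    have h1 := congrArg Complex.re hz
    have h2 := congrArg Complex.im hz
    simp [hG] at h1 h2
    exact hne _ (hclm z) h1 h2
  have hsc : IsSimplyConnected (univ : Set (ℝ × ℝ)) := by
    have : ContractibleSpace (univ : Set (ℝ × ℝ)) :=
      (convex_univ (𝕜 := ℝ)).contractibleSpace univ_nonempty
    exact SimplyConnectedSpace.ofContractible _
  obtain ⟨f, hf, hfG⟩ :=
    Complex.exists_continuousOn_eqOn_exp_comp hsc isOpen_univ hGc.continuousOn hG0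
  rw [continuousOn_univ] at hf
  have hre : ∀ z, Real.exp (f z).re * Real.cos (f z).im = g (cl z) := by
    intro z
    have := congrArg Complex.re (hfG (mem_univ z))
    simpa [hG, Complex.exp_re] using this
  have him : ∀ z, Real.exp (f z).re * Real.sin (f z).im = h (cl z) := by
    intro z
    have := congrArg Complex.im (hfG (mem_univ z))
    simpa [hG, Complex.exp_im] using this
  have cpos : ∀ z, 0 < g (cl z) → 0 < Real.cos (f z).im := fun z hz =>
    pos_of_mul_pos_right ((hre z).symm ▸ hz) (Real.exp_pos _).le
  have spos : ∀ z, 0 < h (cl z) → 0 < Real.sin (f z).im := fun z hz =>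
    pos_of_mul_pos_right ((him z).symm ▸ hz) (Real.exp_pos _).le
  have cneg : ∀ z, g (cl z) < 0 → Real.cos (f z).im < 0 := fun z hz => by
    have := (hre z).symm ▸ hz
    by_contra! h0
    nlinarith [mul_nonneg (Real.exp_pos (f z).re).le h0]
  have sneg : ∀ z, h (cl z) < 0 → Real.sin (f z).im < 0 := fun z hz => by
    have := (him z).symm ▸ hz
    by_contra! h0
    nlinarith [mul_nonneg (Real.exp_pos (f z).re).le h0]
  have hfi : Continuous fun z => (f z).im := Complex.continuous_im.comp hf
  have ha' := left_mem_Icc.2 hab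
  have hb' := right_mem_Icc.2 hab
  have hc' := left_mem_Icc.2 hcd
  have hd' := right_mem_Icc.2 hcd
  have R : ∀ t ∈ Icc c d, 0 < Real.cos (f (b, t)).im := fun t ht =>
    cpos _ (by rw [hcli b hb' t ht]; exact gb t ht)
  have Lf : ∀ t ∈ Icc c d, Real.cos (f (a, t)).im < 0 := fun t ht =>
    cneg _ (by rw [hcli a ha' t ht]; exact ga t ht)
  have U : ∀ s ∈ Icc a b, 0 < Real.sin (f (s, d)).im := fun s hs =>
    spos _ (by rw [hcli s hs d hd']; exact hd s hs)
  have B : ∀ s ∈ Icc a b, Real.sin (f (s, c)).im < 0 := fun s hs =>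
    sneg _ (by rw [hcli s hs c hc']; exact hc s hs)
  -- Along each side the values stay in one half-plane. After the shift that rotates it to the right
  -- half-plane, the argument strictly increases. Going once around gives a cyclic chain of strict
  -- inequalities.
  have e1 : (f (b, c)).im < (f (b, d)).im :=
    angle_lt_of_cos_pos (φ := fun t => (f (b, t)).im) (by fun_prop)
      (fun t ht => R t (by rwa [uIcc_of_le hcd] at ht)) (B b hb') (U b hb')
  have e2 : (f (b, d)).im - Real.pi / 2 < (f (a, d)).im - Real.pi / 2 :=
    angle_lt_of_cos_pos (φ := fun s => (f (s, d)).im - Real.pi / 2) (x := b) (y := a)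
      (by fun_prop)
      (fun s hs => by
        rw [Real.cos_sub_pi_div_two]; exact U s (by rwa [uIcc_of_ge hab] at hs))
      (by simp only [Real.sin_sub_pi_div_two]; linarith [R d hd'])
      (by simp only [Real.sin_sub_pi_div_two]; linarith [Lf d hd'])
  have e3 : (f (a, d)).im - Real.pi < (f (a, c)).im - Real.pi :=
    angle_lt_of_cos_pos (φ := fun t => (f (a, t)).im - Real.pi) (x := d) (y := c)
      (by fun_prop)
      (fun t ht => by
        rw [Real.cos_sub_pi]; linarith [Lf t (by rwa [uIcc_of_ge hcd] at ht)])
      (by simp only [Real.sin_sub_pi]; linarith [U a ha'])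
      (by simp only [Real.sin_sub_pi]; linarith [B a ha'])
  have e4 : (f (a, c)).im + Real.pi / 2 < (f (b, c)).im + Real.pi / 2 :=
    angle_lt_of_cos_pos (φ := fun s => (f (s, c)).im + Real.pi / 2)
      (by fun_prop)
      (fun s hs => by
        rw [Real.cos_add_pi_div_two]; linarith [B s (by rwa [uIcc_of_le hab] at hs)])
      (by simp only [Real.sin_add_pi_div_two]; exact Lf c hc')
      (by simp only [Real.sin_add_pi_div_two]; exact R c hc')
  linarith

/-! ### Connected zero sets that reach every level -/

/-- If no relatively clopen subset of the compact set `Z` separates `x` from the closed set `B`, then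
the connected component of `x` in `Z` meets `B`. -/
lemma exists_mem_connectedComponentIn_of_clopen {X : Type*} [TopologicalSpace X] [T2Space X]
    {Z B : Set X} (hZ : IsCompact Z) (hB : IsClosed B) {x : X} (hx : x ∈ Z)
    (h : ∀ D ⊆ Z, IsCompact D → IsCompact (Z \ D) → x ∈ D → (D ∩ B).Nonempty) :
    (connectedComponentIn Z x ∩ B).Nonempty := by
  have : CompactSpace Z := isCompact_iff_compactSpace.1 hZ
  have hBc : IsCompact ((↑) ⁻¹' B : Set Z) := (hB.preimage continuous_subtype_val).isCompact
  have key : (((↑) ⁻¹' B : Set Z) ∩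
      ⋂ s : {s : Set Z // IsClopen s ∧ (⟨x, hx⟩ : Z) ∈ s}, (s : Set Z)).Nonempty := by
    refine hBc.inter_iInter_nonempty _ (fun s => s.2.1.isClosed) fun u => ?_
    have hcl : IsClopen (⋂ i ∈ u, (i : Set Z)) :=
      u.finite_toSet.isClopen_biInter fun i _ => i.2.1
    have hxm : (⟨x, hx⟩ : Z) ∈ ⋂ i ∈ u, (i : Set Z) := mem_iInter₂.2 fun i _ => i.2.2
    obtain ⟨z, ⟨⟨z', hz', rfl⟩, hzB⟩⟩ := h ((↑) '' (⋂ i ∈ u, (i : Set Z)))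
      (by rintro _ ⟨z, -, rfl⟩; exact z.2)
      (hcl.isClosed.isCompact.image continuous_subtype_val)
      (by
        have : Z \ ((↑) '' (⋂ i ∈ u, (i : Set Z))) = (↑) '' (⋂ i ∈ u, (i : Set Z))ᶜ := by
          rw [image_compl_eq_range_sdiff_image Subtype.val_injective, Subtype.range_coe]
        rw [this]
        exact hcl.compl.isClosed.isCompact.image continuous_subtype_val)
      ⟨_, hxm, rfl⟩
    exact ⟨z', hzB, hz'⟩
  rw [← connectedComponent_eq_iInter_isClopen] at key
  obtain ⟨z, hzB, hz⟩ := key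
  exact ⟨z, by rw [connectedComponentIn_eq_image hx]; exact ⟨z, hz, rfl⟩, hzB⟩

/-- The part of the zero set of `g` in a closed rectangle. -/
def rectZeros (g : ℝ × ℝ → ℝ) (a b c d : ℝ) : Set (ℝ × ℝ) :=
  {z | z ∈ Icc a b ×ˢ Icc c d ∧ g z = 0}

lemma isCompact_rectZeros {g : ℝ × ℝ → ℝ} {a b c d : ℝ}
    (hg : ContinuousOn g (Icc a b ×ˢ Icc c d)) : IsCompact (rectZeros g a b c d) := by
  have hK : IsCompact (Icc a b ×ˢ Icc c d) := isCompact_Icc.prod isCompact_Icc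
  exact hK.of_isClosed_subset (hg.preimage_isClosed_of_isClosed hK.isClosed isClosed_singleton)
    fun z hz => hz.1

/-- The zeros on the top edge that no relatively clopen set separates from the bottom edge. -/
def linkedTop (g : ℝ × ℝ → ℝ) (a b c d : ℝ) : Set (ℝ × ℝ) :=
  {x | x ∈ rectZeros g a b c d ∧ x.2 = d ∧ ∀ D ⊆ rectZeros g a b c d, IsCompact D →
    IsCompact (rectZeros g a b c d \ D) → x ∈ D → (D ∩ {z | z.2 = c}).Nonempty}

/-- Being separated from the bottom is an open condition: a clopen `D` that separates `x` also
contains all zeros near `x`. -/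
lemma isClosed_linkedTop {g : ℝ × ℝ → ℝ} {a b c d : ℝ}
    (hg : ContinuousOn g (Icc a b ×ˢ Icc c d)) : IsClosed (linkedTop g a b c d) := by
  have hZ := isCompact_rectZeros hg
  rw [← isOpen_compl_iff, isOpen_iff_mem_nhds]
  intro x hx
  by_cases hxt : x ∈ rectZeros g a b c d ∧ x.2 = d
  · have : ∃ D ⊆ rectZeros g a b c d, IsCompact D ∧ IsCompact (rectZeros g a b c d \ D) ∧
        x ∈ D ∧ ¬ (D ∩ {z | z.2 = c}).Nonempty := by
      by_contra! hcon
      exact hx ⟨hxt.1, hxt.2, fun D h1 h2 h3 h4 => hcon D h1 h2 h3 h4⟩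
    obtain ⟨D, hD, hDc, hDc', hxD, hDB⟩ := this
    filter_upwards [hDc'.isClosed.isOpen_compl.mem_nhds (fun h => h.2 hxD)] with y hy hyT
    exact hDB (hyT.2.2 D hD hDc hDc' (by by_contra hyD; exact hy ⟨hyT.1, hyD⟩))
  · have hcl : IsClosed (rectZeros g a b c d ∩ {z | z.2 = d}) :=
      hZ.isClosed.inter (isClosed_eq continuous_snd continuous_const)
    filter_upwards [hcl.isOpen_compl.mem_nhds hxt] with y hy hyT
    exact hy ⟨hyT.1, hyT.2.1⟩

/-- A clopen set that avoids the level `c` stays clopen when the rectangle is extended downwards, so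
it would separate in the taller rectangle too. -/
lemma linkedTop_anti {g : ℝ × ℝ → ℝ} {a b c c' d : ℝ} (hcc : c' ≤ c) (hcd : c ≤ d)
    (hg : ContinuousOn g (Icc a b ×ˢ Icc c' d)) :
    linkedTop g a b c' d ⊆ linkedTop g a b c d := by
  have hsub : rectZeros g a b c d ⊆ rectZeros g a b c' d := fun z hz =>
    ⟨⟨hz.1.1, hcc.trans hz.1.2.1, hz.1.2.2⟩, hz.2⟩
  rintro x ⟨hx, hxd, hxl⟩
  refine ⟨⟨⟨hx.1.1, hxd ▸ hcd, hxd.le⟩, hx.2⟩, hxd, fun D hD hDc hDc' hxD => ?_⟩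
  by_contra hne
  have hlow : ∀ z ∈ D, c < z.2 := fun z hz =>
    lt_of_le_of_ne (hD hz).1.2.1 fun h => hne ⟨z, hz, h.symm⟩
  have heq : rectZeros g a b c' d \ D =
      (rectZeros g a b c d \ D) ∪ (rectZeros g a b c' d ∩ {z | z.2 ≤ c}) := by
    ext z
    constructor
    · rintro ⟨hz, hzD⟩
      rcases le_total z.2 c with h | h
      · exact Or.inr ⟨hz, h⟩
      · exact Or.inl ⟨⟨⟨hz.1.1, h, hz.1.2.2⟩, hz.2⟩, hzD⟩
    · rintro (⟨hz, hzD⟩ | ⟨hz, hzc⟩)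
      · exact ⟨hsub hz, hzD⟩
      · exact ⟨hz, fun hzD => absurd (hlow z hzD) (not_lt.2 hzc)⟩
  obtain ⟨z, hz, hzc⟩ := hxl D (hD.trans hsub) hDc (heq ▸ hDc'.union
    ((isCompact_rectZeros hg).inter_right (isClosed_le continuous_snd continuous_const))) hxD
  have := hlow z hz
  simp only [mem_ofPred_eq] at hzc
  linarith

/-- Otherwise compactness gives one clopen `D` containing all top zeros and missing the bottom edge.
A Urysohn function equal to 1 on `D` and the top edge, and to 0 on the other zeros and the bottom
edge, never takes the value 1/2 on the zeros. This contradicts Poincaré–Miranda. -/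
lemma linkedTop_nonempty {g : ℝ × ℝ → ℝ} {a b c d : ℝ} (hab : a ≤ b) (hcd : c < d)
    (hg : ContinuousOn g (Icc a b ×ˢ Icc c d))
    (ga : ∀ t ∈ Icc c d, g (a, t) < 0) (gb : ∀ t ∈ Icc c d, 0 < g (b, t)) :
    (linkedTop g a b c d).Nonempty := by
  by_contra hemp
  set Z := rectZeros g a b c d with hZdef
  have hZ : IsCompact Z := isCompact_rectZeros hg
  have hsep : ∀ x ∈ Z ∩ {z | z.2 = d}, ∃ D ⊆ Z, IsCompact D ∧ IsCompact (Z \ D) ∧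
      x ∈ D ∧ ¬ (D ∩ {z | z.2 = c}).Nonempty := by
    intro x hx
    by_contra! hcon
    exact hemp ⟨x, hx.1, hx.2, fun D h1 h2 h3 h4 => hcon D h1 h2 h3 h4⟩
  have htop : IsCompact (Z ∩ {z : ℝ × ℝ | z.2 = d}) :=
    hZ.inter_right (isClosed_eq continuous_snd continuous_const)
  obtain ⟨D, hD, hDc, hDc', htD, hDB⟩ : ∃ D ⊆ Z, IsCompact D ∧ IsCompact (Z \ D) ∧
      (Z ∩ {z : ℝ × ℝ | z.2 = d}) ∩ Z ⊆ D ∧ ¬ (D ∩ {z | z.2 = c}).Nonempty := by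
    refine htop.induction_on (p := fun s => ∃ D ⊆ Z, IsCompact D ∧ IsCompact (Z \ D) ∧
      s ∩ Z ⊆ D ∧ ¬ (D ∩ {z | z.2 = c}).Nonempty) ?_ ?_ ?_ ?_
    · exact ⟨∅, empty_subset _, isCompact_empty, by simpa using hZ, by simp, by simp⟩
    · rintro s t hst ⟨D, h1, h2, h3, h4, h5⟩
      exact ⟨D, h1, h2, h3, (inter_subset_inter_left _ hst).trans h4, h5⟩
    · rintro s t ⟨D, h1, h2, h3, h4, h5⟩ ⟨E, k1, k2, k3, k4, k5⟩
      refine ⟨D ∪ E, union_subset h1 k1, h2.union k2, ?_, ?_, ?_⟩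
      · have : Z \ (D ∪ E) = (Z \ D) ∩ (Z \ E) := by
          ext z; simp only [mem_sdiff, mem_union, mem_inter_iff]; tauto
        rw [this]
        exact h3.inter k3
      · rw [union_inter_distrib_right]
        exact union_subset_union h4 k4
      · rw [union_inter_distrib_right, union_nonempty]
        exact not_or.2 ⟨h5, k5⟩
    · intro x hx
      obtain ⟨D, h1, h2, h3, h4, h5⟩ := hsep x hx
      refine ⟨(Z \ D)ᶜ, mem_nhdsWithin_of_mem_nhds
        (h3.isClosed.isOpen_compl.mem_nhds fun h => h.2 h4), D, h1, h2, h3, ?_, h5⟩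
      rintro y ⟨hy, hyZ⟩
      by_contra hyD
      exact hy ⟨hyZ, hyD⟩
  have hedge : ∀ r : ℝ, IsClosed (Icc a b ×ˢ ({r} : Set ℝ)) := fun r =>
    isClosed_Icc.prod isClosed_singleton
  have hdisj : Disjoint ((Z \ D) ∪ Icc a b ×ˢ ({c} : Set ℝ)) (D ∪ Icc a b ×ˢ ({d} : Set ℝ)) := by
    rw [Set.disjoint_left]
    rintro ⟨s, t⟩ (⟨hz, hzD⟩ | ⟨hs, ht⟩) (hw | ⟨hs', ht'⟩)
    · exact hzD hw
    · exact hzD (htD ⟨⟨hz, ht'⟩, hz⟩)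
    · exact hDB ⟨_, hw, ht⟩
    · simp only [mem_singleton_iff] at ht ht'
      exact hcd.ne (ht.symm.trans ht')
  obtain ⟨f, hf0, hf1, -⟩ := exists_continuous_zero_one_of_isClosed
    (hDc'.isClosed.union (hedge c)) (hDc.isClosed.union (hedge d)) hdisj
  obtain ⟨z, hz, hgz, hfz⟩ := exists_common_zero_rectangle (h := fun z => f z - 1 / 2) hab hcd.le hg
    (by fun_prop) ga gb
    (fun s hs => by
      have := hf0 (show (s, c) ∈ _ from Or.inr ⟨hs, rfl⟩)
      simp only [Pi.zero_apply] at this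
      rw [this]; norm_num)
    (fun s hs => by
      have := hf1 (show (s, d) ∈ _ from Or.inr ⟨hs, rfl⟩)
      simp only [Pi.one_apply] at this
      rw [this]; norm_num)
  have hzZ : z ∈ Z := ⟨hz, hgz⟩
  by_cases hzD : z ∈ D
  · have := hf1 (show z ∈ _ from Or.inl hzD)
    simp only [Pi.one_apply] at this
    rw [this] at hfz; norm_num at hfz
  · have := hf0 (show z ∈ _ from Or.inl ⟨hzZ, hzD⟩)
    simp only [Pi.zero_apply] at this
    rw [this] at hfz; norm_num at hfz

/-- If `g` is negative on the left edge and positive on the right edge of `[a, b] × (0, d]`, then its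
zero set contains a connected set that meets all horizontal levels. -/
theorem exists_connected_zeros_crossing {g : ℝ × ℝ → ℝ} {a b d : ℝ} (hab : a ≤ b) (hd : 0 < d)
    (hg : ContinuousOn g (univ ×ˢ Ioi 0))
    (ga : ∀ t ∈ Ioc 0 d, g (a, t) < 0) (gb : ∀ t ∈ Ioc 0 d, 0 < g (b, t)) :
    ∃ C : Set (ℝ × ℝ), C ⊆ Icc a b ×ˢ Ioc 0 d ∧ (∀ z ∈ C, g z = 0) ∧ IsConnected C ∧
      ∀ t ∈ Ioc 0 d, ∃ z ∈ C, z.2 = t := by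
  -- The shift by 2 keeps `c n` strictly below `d` already at `n = 0`.
  set c : ℕ → ℝ := fun n => d / (n + 2) with hc
  have hc0 : ∀ n, 0 < c n := fun n => by positivity
  have hcd : ∀ n, c n < d := fun n => by
    rw [hc]; simp only
    rw [div_lt_iff₀ (by positivity)]
    have : (0 : ℝ) ≤ n := n.cast_nonneg
    nlinarith
  have hcanti : ∀ n, c (n + 1) ≤ c n := fun n => by
    simp only [hc]
    gcongr
    linarith
  have hgn : ∀ n, ContinuousOn g (Icc a b ×ˢ Icc (c n) d) := fun n =>
    hg.mono fun z hz => ⟨mem_univ _, (hc0 n).trans_le hz.2.1⟩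
  -- Cantor's intersection theorem provides a single top point linked to all levels `c n`. Its
  -- components in the growing rectangles share this point, so their union is connected.
  have hne : (⋂ n, linkedTop g a b (c n) d).Nonempty := by
    refine IsCompact.nonempty_iInter_of_sequence_nonempty_isCompact_isClosed _ (fun n => ?_)
      (fun n => ?_) ?_ (fun n => isClosed_linkedTop (hgn n))
    · exact linkedTop_anti (hcanti n) (hcd n).le (hgn (n + 1))
    · exact linkedTop_nonempty hab (hcd n) (hgn n)
        (fun t ht => ga t ⟨(hc0 n).trans_le ht.1, ht.2⟩)
        (fun t ht => gb t ⟨(hc0 n).trans_le ht.1, ht.2⟩)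
    · exact (isCompact_rectZeros (hgn 0)).of_isClosed_subset (isClosed_linkedTop (hgn 0))
        fun z hz => hz.1
  obtain ⟨x, hx⟩ := hne
  rw [mem_iInter] at hx
  have hmem : ∀ n, x ∈ connectedComponentIn (rectZeros g a b (c n) d) x := fun n =>
    mem_connectedComponentIn (hx n).1
  refine ⟨⋃ n, connectedComponentIn (rectZeros g a b (c n) d) x, ?_, ?_, ⟨?_, ?_⟩, ?_⟩
  · refine iUnion_subset fun n z hz => ?_
    have := (connectedComponentIn_subset _ _ hz).1
    exact ⟨this.1, (hc0 n).trans_le this.2.1, this.2.2⟩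
  · intro z hz
    obtain ⟨n, hn⟩ := mem_iUnion.1 hz
    exact (connectedComponentIn_subset _ _ hn).2
  · exact ⟨x, mem_iUnion.2 ⟨0, hmem 0⟩⟩
  · exact isPreconnected_iUnion ⟨x, mem_iInter.2 hmem⟩ fun n => isPreconnected_connectedComponentIn
  · intro t ht
    obtain ⟨n, hn⟩ : ∃ n : ℕ, c n ≤ t := by
      obtain ⟨n, hn⟩ := exists_nat_gt (d / t)
      refine ⟨n, ?_⟩
      simp only [hc]
      rw [div_lt_iff₀ ht.1] at hn
      rw [div_le_iff₀ (by positivity)]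
      nlinarith [ht.1]
    obtain ⟨z, hz, hzc⟩ := exists_mem_connectedComponentIn_of_clopen (isCompact_rectZeros (hgn n))
      (isClosed_eq continuous_snd continuous_const) (hx n).1 (hx n).2.2
    have hpre : IsPreconnected (Prod.snd '' connectedComponentIn (rectZeros g a b (c n) d) x) :=
      isPreconnected_connectedComponentIn.image _ continuous_snd.continuousOn
    obtain ⟨w, hw, hwt⟩ := hpre.Icc_subset ⟨z, hz, rfl⟩ ⟨x, hmem n, rfl⟩
      (show t ∈ Icc z.2 x.2 from ⟨hzc.trans_le hn, ht.2.trans_eq (hx n).2.1.symm⟩)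
    exact ⟨w, mem_iUnion.2 ⟨n, hw⟩, hwt⟩

/-! ### Plane geometry: supporting lines and tangent directions -/

lemma plane_expand {e n : Plane} (he : ‖e‖ = 1) (hn : ‖n‖ = 1) (hen : ⟪e, n⟫ = 0) (v : Plane) :
    v = ⟪v, e⟫ • e + ⟪v, n⟫ • n := by
  have hon : Orthonormal ℝ ![e, n] := by
    refine ⟨fun i => by fin_cases i <;> simp [he, hn], fun i j hij => ?_⟩
    fin_cases i <;> fin_cases j <;> simp_all [real_inner_comm]
  have hcard : Fintype.card (Fin 2) = Module.finrank ℝ Plane := by simp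
  have hspan := (basisOfOrthonormalOfCardEqFinrank hon hcard).span_eq
  rw [coe_basisOfOrthonormalOfCardEqFinrank] at hspan
  have := (OrthonormalBasis.mk hon hspan.ge).sum_repr' v
  simp only [OrthonormalBasis.coe_mk, Fin.sum_univ_two, Matrix.cons_val_zero,
    Matrix.cons_val_one] at this
  rw [real_inner_comm e v, real_inner_comm n v]
  exact this.symm

/-- An interior point can be moved along `m`. This nondegeneracy makes the outward normal unique and
the two tangent rays distinct. -/
lemma not_forall_inner_eq {S : Set Plane} (hint : (interior S).Nonempty) {m : Plane} (hm : m ≠ 0)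
    (r : ℝ) : ¬ ∀ y ∈ S, ⟪y, m⟫ = r := by
  intro h
  obtain ⟨y, hy⟩ := hint
  obtain ⟨ε, hε, hball⟩ := Metric.isOpen_iff.1 isOpen_interior y hy
  have h1 := h y (interior_subset hy)
  have hmpos : 0 < ‖m‖ := norm_pos_iff.2 hm
  have hz : y + (ε / (2 * ‖m‖)) • m ∈ ball y ε := by
    rw [mem_ball, dist_eq_norm, add_sub_cancel_left, norm_smul, Real.norm_eq_abs,
      abs_of_pos (by positivity)]
    field_simp
    linarith
  have h2 := h _ (interior_subset (hball hz))
  rw [inner_add_left, inner_smul_left, h1, real_inner_self_eq_norm_sq] at h2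
  have : 0 < ε / (2 * ‖m‖) * ‖m‖ ^ 2 := by positivity
  simp only [conj_trivial] at h2
  linarith

lemma not_mem_interior_of_support {S : Set Plane} {m y : Plane} (hm : m ≠ 0)
    (h : ∀ y' ∈ S, ⟪y' - y, m⟫ ≤ 0) : y ∉ interior S := by
  intro hy
  obtain ⟨ε, hε, hball⟩ := Metric.isOpen_iff.1 isOpen_interior y hy
  have hmpos : 0 < ‖m‖ := norm_pos_iff.2 hm
  have hz : y + (ε / (2 * ‖m‖)) • m ∈ ball y ε := by
    rw [mem_ball, dist_eq_norm, add_sub_cancel_left, norm_smul, Real.norm_eq_abs,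
      abs_of_pos (by positivity)]
    field_simp
    linarith
  have h2 := h _ (interior_subset (hball hz))
  rw [add_sub_cancel_left, inner_smul_left, real_inner_self_eq_norm_sq] at h2
  have : 0 < ε / (2 * ‖m‖) * ‖m‖ ^ 2 := by positivity
  simp only [conj_trivial] at h2
  linarith

lemma mem_frontier_of_support {S : Set Plane} {m y : Plane} (hy : y ∈ S) (hm : m ≠ 0)
    (h : ∀ y' ∈ S, ⟪y' - y, m⟫ ≤ 0) : y ∈ frontier S :=
  ⟨subset_closure hy, not_mem_interior_of_support hm h⟩

/-- Seen from the point `c + t • n`, the largest slope, measured in the direction `e` against the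
depth in the direction `-n`, of a point of `S`. -/
def upperSlope (S : Set Plane) (c e n : Plane) (t : ℝ) : ℝ :=
  sSup ((fun y => ⟪y - c, e⟫ / (t - ⟪y - c, n⟫)) '' S)

/-- The unit vector of slope `q` in the frame `e`, `-n`. -/
def slopeDir (e n : Plane) (q : ℝ) : Plane := (Real.sqrt (1 + q ^ 2))⁻¹ • (q • e - n)

/-- `e`, `n` is an orthonormal frame at `c ∈ S` such that `n` is an outward normal of `S`. -/
structure ContactFrame (S : Set Plane) (c e n : Plane) : Prop where
  mem : c ∈ S
  norm_e : ‖e‖ = 1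
  norm_n : ‖n‖ = 1
  orth : ⟪e, n⟫ = 0
  support : ∀ y ∈ S, ⟪y - c, n⟫ ≤ 0

namespace ContactFrame

variable {S : Set Plane} {c e n : Plane}

lemma neg (h : ContactFrame S c e n) : ContactFrame S c (-e) n :=
  ⟨h.mem, by simpa using h.norm_e, h.norm_n, by simpa using h.orth, h.support⟩

lemma n_ne_zero (h : ContactFrame S c e n) : n ≠ 0 := by
  intro h0; simpa [h0] using h.norm_n

lemma depth_pos (h : ContactFrame S c e n) {t : ℝ} (ht : 0 < t) {y : Plane} (hy : y ∈ S) :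
    0 < t - ⟪y - c, n⟫ := by linarith [h.support y hy]

lemma continuousOn_slope (h : ContactFrame S c e n) {t : ℝ} (ht : 0 < t) :
    ContinuousOn (fun y => ⟪y - c, e⟫ / (t - ⟪y - c, n⟫)) S := by
  refine ContinuousOn.div (by fun_prop) (by fun_prop) fun y hy => (h.depth_pos ht hy).ne'

lemma slope_le (h : ContactFrame S c e n) (hS : IsCompact S) {t : ℝ} (ht : 0 < t) {y : Plane}
    (hy : y ∈ S) : ⟪y - c, e⟫ / (t - ⟪y - c, n⟫) ≤ upperSlope S c e n t :=
  le_csSup (hS.bddAbove_image (h.continuousOn_slope ht)) (mem_image_of_mem _ hy)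

lemma exists_slope_eq (h : ContactFrame S c e n) (hS : IsCompact S) {t : ℝ} (ht : 0 < t) :
    ∃ y ∈ S, ⟪y - c, e⟫ / (t - ⟪y - c, n⟫) = upperSlope S c e n t := by
  obtain ⟨y, hy, hy'⟩ := hS.exists_sSup_image_eq ⟨c, h.mem⟩ (h.continuousOn_slope ht)
  exact ⟨y, hy, hy'.symm⟩

lemma inner_slopeDir_normal (h : ContactFrame S c e n) (q : ℝ) :
    ⟪slopeDir e n q, n⟫ = -(Real.sqrt (1 + q ^ 2))⁻¹ := by
  simp [slopeDir, inner_smul_left, inner_sub_left, h.orth, h.norm_n]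

lemma inner_slopeDir_tangent (h : ContactFrame S c e n) (q : ℝ) :
    ⟪slopeDir e n q, e⟫ = (Real.sqrt (1 + q ^ 2))⁻¹ * q := by
  simp [slopeDir, inner_smul_left, inner_sub_left, real_inner_comm e n, h.orth, h.norm_e]

lemma norm_sq_frame (h : ContactFrame S c e n) (a b : ℝ) :
    ‖a • e + b • n‖ ^ 2 = a ^ 2 + b ^ 2 := by
  rw [@norm_add_sq_real]
  simp [norm_smul, inner_smul_left, inner_smul_right, h.orth, h.norm_e, h.norm_n]

lemma norm_slopeDir (h : ContactFrame S c e n) (q : ℝ) : ‖slopeDir e n q‖ = 1 := by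
  have hs : 0 < Real.sqrt (1 + q ^ 2) := Real.sqrt_pos.2 (by positivity)
  have h1 : ‖q • e - n‖ = Real.sqrt (1 + q ^ 2) := by
    have := h.norm_sq_frame q (-1)
    rw [neg_one_smul, ← sub_eq_add_neg] at this
    rw [← Real.sqrt_sq (norm_nonneg (q • e - n)), this]
    congr 1; ring
  rw [slopeDir, norm_smul, h1, norm_inv, Real.norm_of_nonneg hs.le, inv_mul_cancel₀ hs.ne']

/-- A point of `S` in terms of its depth and slope seen from `c + t • n`. -/
lemma sub_eq_depth_smul (h : ContactFrame S c e n) {t : ℝ} (ht : 0 < t) {y : Plane} (hy : y ∈ S) :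
    y - (c + t • n) =
      (t - ⟪y - c, n⟫) • ((⟪y - c, e⟫ / (t - ⟪y - c, n⟫)) • e - n) := by
  have hd := (h.depth_pos ht hy).ne'
  rw [smul_sub, smul_smul, mul_div_cancel₀ _ hd]
  conv_lhs => rw [← sub_sub, plane_expand h.norm_e h.norm_n h.orth (y - c)]
  module

lemma sub_eq_smul_slopeDir (h : ContactFrame S c e n) {t : ℝ} (ht : 0 < t) {y : Plane}
    (hy : y ∈ S) :
    y - (c + t • n) =
      ((t - ⟪y - c, n⟫) * Real.sqrt (1 + (⟪y - c, e⟫ / (t - ⟪y - c, n⟫)) ^ 2)) •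
        slopeDir e n (⟪y - c, e⟫ / (t - ⟪y - c, n⟫)) := by
  have hs : Real.sqrt (1 + (⟪y - c, e⟫ / (t - ⟪y - c, n⟫)) ^ 2) ≠ 0 :=
    (Real.sqrt_pos.2 (by positivity)).ne'
  rw [slopeDir, smul_smul, mul_assoc, mul_inv_cancel₀ hs, mul_one]
  exact h.sub_eq_depth_smul ht hy

/-- A linear functional at a point of `S`, in terms of its depth and slope seen from `c + t • n`. -/
lemma inner_sub_eq (h : ContactFrame S c e n) {t : ℝ} (ht : 0 < t) {y : Plane}
    (hy : y ∈ S) (α β : ℝ) :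
    ⟪y - (c + t • n), α • e + β • n⟫ =
      (t - ⟪y - c, n⟫) * (α * (⟪y - c, e⟫ / (t - ⟪y - c, n⟫)) - β) := by
  rw [h.sub_eq_depth_smul ht hy]
  simp only [inner_smul_left, inner_sub_left, inner_add_right, inner_smul_right, h.orth,
    real_inner_comm e n, real_inner_self_eq_norm_sq, h.norm_e, h.norm_n]
  simp only [conj_trivial]
  ring

/-- The ray through a maximizer of the slope is tangent: `e + q • n` is orthogonal to it, and since
depths are positive, the slope bound `q` is the supporting inequality for this normal. -/
lemma isTangentDirection_slopeDir (h : ContactFrame S c e n) (hS : IsCompact S) {t : ℝ}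
    (ht : 0 < t) : IsTangentDirection S (c + t • n) (slopeDir e n (upperSlope S c e n t)) := by
  obtain ⟨y, hy, hyq⟩ := h.exists_slope_eq hS ht
  set q := upperSlope S c e n t with hq
  have hs : 0 < Real.sqrt (1 + q ^ 2) := Real.sqrt_pos.2 (by positivity)
  refine ⟨h.norm_slopeDir q, ⟨(t - ⟪y - c, n⟫) * Real.sqrt (1 + q ^ 2),
    mul_nonneg (h.depth_pos ht hy).le hs.le, ?_⟩,
    (Real.sqrt (1 + q ^ 2))⁻¹ • ((1 : ℝ) • e + q • n), ?_, ?_, ?_⟩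
  · have := h.sub_eq_smul_slopeDir ht hy
    rw [hyq] at this
    rw [← this]; simpa using hy
  · rw [norm_smul, norm_inv, Real.norm_of_nonneg hs.le,
      ← Real.sqrt_sq (norm_nonneg ((1 : ℝ) • e + q • n)), h.norm_sq_frame 1 q, one_pow,
      inv_mul_cancel₀ hs.ne']
  · rw [inner_smul_right, inner_add_right, inner_smul_right, inner_smul_right,
      h.inner_slopeDir_normal, h.inner_slopeDir_tangent]
    ring
  · intro y' hy'
    rw [inner_smul_right, h.inner_sub_eq ht hy']
    refine mul_nonpos_of_nonneg_of_nonpos (inv_nonneg.2 hs.le)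
      (mul_nonpos_of_nonneg_of_nonpos (h.depth_pos ht hy').le ?_)
    linarith [h.slope_le hS ht hy']

lemma slopeDir_neg (q : ℝ) : slopeDir (-e) n (-q) = slopeDir e n q := by
  simp [slopeDir]

lemma upperSlope_eq (h : ContactFrame S c e n) (hS : IsCompact S) {t : ℝ} (ht : 0 < t)
    {y : Plane} (hy : y ∈ S)
    (hmax : ∀ y' ∈ S, ⟪y' - c, e⟫ / (t - ⟪y' - c, n⟫) ≤ ⟪y - c, e⟫ / (t - ⟪y - c, n⟫)) :
    upperSlope S c e n t = ⟪y - c, e⟫ / (t - ⟪y - c, n⟫) := by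
  obtain ⟨y', hy', h'⟩ := h.exists_slope_eq hS ht
  exact le_antisymm (h' ▸ hmax y' hy') (h.slope_le hS ht hy)

/-- A normal `α • e + β • n` of the supporting line satisfies `β = α * q`, with `q` the slope of the
ray. The sign of `α` decides whether `q` is the largest or the smallest slope of `S`. -/
lemma eq_slopeDir_of_isTangentDirection (h : ContactFrame S c e n) (hS : IsCompact S) {t : ℝ}
    (ht : 0 < t) {d : Plane} (hd : IsTangentDirection S (c + t • n) d) :
    d = slopeDir e n (upperSlope S c e n t) ∨
      d = slopeDir (-e) n (upperSlope S c (-e) n t) := by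
  obtain ⟨hd1, ⟨τ, hτ, hy⟩, m, hm, hdm, hsup⟩ := hd
  set y := c + t • n + τ • d with hydef
  have hyp : y - (c + t • n) = τ • d := by rw [hydef, add_sub_cancel_left]
  have hA := h.sub_eq_smul_slopeDir ht hy
  have hdep := h.depth_pos ht hy
  set q := ⟪y - c, e⟫ / (t - ⟪y - c, n⟫) with hq
  have hs : 0 < Real.sqrt (1 + q ^ 2) := Real.sqrt_pos.2 (by positivity)
  have hApos : 0 < (t - ⟪y - c, n⟫) * Real.sqrt (1 + q ^ 2) := mul_pos hdep hs
  have hτA : τ = (t - ⟪y - c, n⟫) * Real.sqrt (1 + q ^ 2) := by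
    have h1 := congrArg norm (hyp.symm.trans hA)
    rwa [norm_smul, norm_smul, hd1, h.norm_slopeDir, mul_one, mul_one, Real.norm_of_nonneg hτ,
      Real.norm_of_nonneg hApos.le] at h1
  have hdq : d = slopeDir e n q := by
    have h1 := hyp.symm.trans hA
    rw [hτA] at h1
    exact smul_right_injective _ hApos.ne' h1
  have hmexp := plane_expand h.norm_e h.norm_n h.orth m
  set α := ⟪m, e⟫
  set β := ⟪m, n⟫
  have hβ : β = α * q := by
    have h1 : ⟪y - (c + t • n), m⟫ = 0 := by rw [hyp, inner_smul_left, hdm, mul_zero]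
    rw [hmexp, h.inner_sub_eq ht hy] at h1
    rcases mul_eq_zero.1 h1 with h1 | h1
    · exact absurd h1 hdep.ne'
    · linarith
  have hcomp : ∀ y' ∈ S, α * (⟪y' - c, e⟫ / (t - ⟪y' - c, n⟫) - q) ≤ 0 := by
    intro y' hy'
    have h1 := hsup y' hy'
    rw [hmexp, h.inner_sub_eq ht hy', hβ] at h1
    have := h.depth_pos ht hy'
    by_contra! hc
    nlinarith [mul_pos this hc]
  have hα : α ≠ 0 := by
    intro h0
    rw [hβ, h0] at hmexp
    simp only [zero_mul, zero_smul, add_zero] at hmexp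
    simp [hmexp] at hm
  rcases lt_or_gt_of_ne hα with hα | hα
  · right
    have : upperSlope S c (-e) n t = -q := by
      rw [h.neg.upperSlope_eq hS ht hy, inner_neg_right, neg_div]
      intro y' hy'
      rw [inner_neg_right, inner_neg_right, neg_div, neg_div, neg_le_neg_iff]
      have := hcomp y' hy'
      by_contra! hc
      nlinarith [mul_pos_of_neg_of_neg hα (sub_neg.2 hc)]
    rw [this, slopeDir_neg, hdq]
  · left
    rw [h.upperSlope_eq hS ht hy, hdq]
    intro y' hy'
    have := hcomp y' hy'
    by_contra! hc
    nlinarith [mul_pos hα (sub_pos.2 hc)]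

/-- If the largest and smallest slopes coincided, `S` would lie on one line through the viewpoint.
-/
lemma upperSlope_ne (h : ContactFrame S c e n) (hS : IsCompact S) (hint : (interior S).Nonempty)
    {t : ℝ} (ht : 0 < t) : upperSlope S c e n t ≠ -upperSlope S c (-e) n t := by
  intro heq
  set q := upperSlope S c e n t with hq
  have hne : e + q • n ≠ 0 := by
    intro h0
    have := congrArg (fun v => ⟪v, e⟫) h0
    simp only [inner_add_left, inner_smul_left, real_inner_comm e n, h.orth,
      real_inner_self_eq_norm_sq, h.norm_e, inner_zero_left] at this
    norm_num at this
  refine not_forall_inner_eq hint hne (⟪c, e + q • n⟫ + q * t) fun y hy => ?_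
  have h1 := h.slope_le hS ht hy
  have h2 := h.neg.slope_le hS ht hy
  have hd := h.depth_pos ht hy
  rw [inner_neg_right, neg_div] at h2
  have h3 : ⟪y - c, e⟫ / (t - ⟪y - c, n⟫) = q := le_antisymm h1 (by linarith)
  rw [div_eq_iff hd.ne'] at h3
  rw [← sub_eq_iff_eq_add', ← inner_sub_left, inner_add_right, inner_smul_right, h3]
  ring

lemma slopeDir_ne (h : ContactFrame S c e n) {q r : ℝ} (hqr : q ≠ r) :
    slopeDir e n q ≠ slopeDir e n r := by
  intro heq
  have h1 := h.inner_slopeDir_normal q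
  have h2 := h.inner_slopeDir_tangent q
  rw [heq, h.inner_slopeDir_normal] at h1
  rw [heq, h.inner_slopeDir_tangent, ← neg_eq_iff_eq_neg.2 h1, neg_neg] at h2
  have hs : (Real.sqrt (1 + r ^ 2))⁻¹ ≠ 0 := (inv_pos.2 (Real.sqrt_pos.2 (by positivity))).ne'
  exact hqr (mul_left_cancel₀ hs h2).symm

/-! ### Fixed points on the outward normals -/

lemma hitTime_eq (h : ContactFrame S c e n) {t : ℝ} (ht : 0 < t) :
    hitTime S (c + t • n, -n) = t := by
  refine IsLeast.csInf_eq ⟨⟨ht.le, by simpa using h.mem⟩, ?_⟩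
  rintro τ ⟨hτ, hmem⟩
  have h1 := h.support _ hmem
  have : c + t • n + τ • -n - c = (t - τ) • n := by module
  simp only at h1
  rw [this, inner_smul_left, real_inner_self_eq_norm_sq, h.norm_n] at h1
  simp at h1
  exact h1

lemma infDist_eq (h : ContactFrame S c e n) {t : ℝ} (ht : 0 < t) :
    infDist (c + t • n) S = t := by
  refine le_antisymm ?_ ?_
  · refine (infDist_le_dist_of_mem h.mem).trans_eq ?_
    rw [dist_eq_norm, add_sub_cancel_left, norm_smul, h.norm_n, mul_one, Real.norm_of_nonneg ht.le]
  · refine (le_infDist ⟨c, h.mem⟩).2 fun y hy => ?_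
    have h1 : ⟪c + t • n - y, n⟫ ≤ ‖c + t • n - y‖ * ‖n‖ := real_inner_le_norm _ _
    rw [h.norm_n, mul_one, ← dist_eq_norm] at h1
    have h2 : ⟪c + t • n - y, n⟫ = t - ⟪y - c, n⟫ := by
      simp only [inner_sub_left, inner_add_left, inner_smul_left, real_inner_self_eq_norm_sq,
        h.norm_n, conj_trivial]
      ring
    linarith [h.support y hy]

lemma mirror_eq_neg {n x : Plane} (hx : x = -n) : mirror n x = n := by
  subst hx
  rw [mirror, Submodule.reflection_orthogonal_apply, map_neg, neg_neg]
  exact Submodule.reflection_mem_subspace_eq_self (Submodule.mem_span_singleton_self n)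

lemma mirror_eq_self {m x : Plane} (h : ⟪m, x⟫ = 0) : mirror m x = x := by
  rw [mirror, Submodule.reflection_eq_self_iff]
  exact Submodule.mem_orthogonal_singleton_iff_inner_right.2 h

/-- The point at height `t` on the outward normal is a fixed point as soon as the normal bisects the
angle of the two tangent rays. -/
theorem mem_exteriorFixedPoints (h : ContactFrame S c e n) (hS : IsCompact S)
    (hint : (interior S).Nonempty) (huniq : ∀ m, IsOuterNormal S c m → m = n) {t : ℝ} (ht : 0 < t)
    (heq : upperSlope S c e n t = upperSlope S c (-e) n t) :
    (c + t • n, -n) ∈ exteriorFixedPoints S := by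
  have hnS : c + t • n ∉ S := by
    intro hmem
    have := h.infDist_eq ht
    rw [infDist_zero_of_mem hmem] at this
    exact ht.ne this
  have hhit := h.hitTime_eq ht
  have hb : bouncePoint S (c + t • n, -n) = c := by
    simp [bouncePoint, hhit]
  have hν : outerNormal S c = n :=
    huniq _ (Classical.epsilon_spec ⟨n, h.norm_n, h.support⟩)
  have hdir : bouncedDirection S (c + t • n, -n) = n := by
    rw [bouncedDirection, hb, hν]
    exact mirror_eq_neg rfl
  have hnew : newPoint S (c + t • n, -n) = c + t • n := by
    rw [newPoint, hb, hhit, hdir]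
  -- The pair is an arbitrary choice, so only its defining property is available. The two extremal
  -- slopes show that this property can be satisfied.
  have hspec : (tangentDirections S (c + t • n)).1 ≠ (tangentDirections S (c + t • n)).2 ∧
      IsTangentDirection S (c + t • n) (tangentDirections S (c + t • n)).1 ∧
      IsTangentDirection S (c + t • n) (tangentDirections S (c + t • n)).2 := by
    refine Classical.epsilon_spec (p := fun d : Plane × Plane =>
      d.1 ≠ d.2 ∧ IsTangentDirection S (c + t • n) d.1 ∧ IsTangentDirection S (c + t • n) d.2)
      ⟨(slopeDir e n (upperSlope S c e n t), slopeDir (-e) n (upperSlope S c (-e) n t)), ?_,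
        h.isTangentDirection_slopeDir hS ht, h.neg.isTangentDirection_slopeDir hS ht⟩
    have := h.slopeDir_ne (h.upperSlope_ne hS hint ht)
    rwa [← slopeDir_neg (-upperSlope S c (-e) n t), neg_neg] at this
  -- With equal slopes all tangent directions have the same component along `n`. Whichever two were
  -- chosen, their difference is orthogonal to `n`, so the bisector reflection fixes `-n`.
  have hnorm : ∀ d, IsTangentDirection S (c + t • n) d →
      ⟪d, n⟫ = -(Real.sqrt (1 + upperSlope S c e n t ^ 2))⁻¹ := by
    intro d hd
    rcases h.eq_slopeDir_of_isTangentDirection hS ht hd with rfl | rfl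
    · exact h.inner_slopeDir_normal _
    · rw [h.neg.inner_slopeDir_normal, heq]
  have hbis : bisectorReflection S (c + t • n) (-n) = -n := by
    refine mirror_eq_self ?_
    rw [inner_neg_right, inner_sub_left, hnorm _ hspec.2.1, hnorm _ hspec.2.2, sub_self, neg_zero]
  refine ⟨⟨fun hi => hnS (interior_subset hi), by simpa using h.norm_n, t, ht.le, ?_⟩, hnS, ?_⟩
  · simpa using h.mem
  · rw [bouncingOuterBilliard, hnew, hdir, hbis]

end ContactFrame

/-! ### The moving frame of the boundary -/

/-- Rotation of the plane by a right angle. -/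
def quarterTurn : Plane →L[ℝ] Plane :=
  LinearMap.toContinuousLinearMap
    { toFun := fun v => !₂[-v 1, v 0]
      map_add' := fun v w => by ext i; fin_cases i <;> simp [add_comm]
      map_smul' := fun r v => by ext i; fin_cases i <;> simp }

lemma quarterTurn_apply (v : Plane) : quarterTurn v = !₂[-v 1, v 0] := rfl

lemma norm_quarterTurn (v : Plane) : ‖quarterTurn v‖ = ‖v‖ := by
  simp [quarterTurn_apply, EuclideanSpace.norm_eq, Fin.sum_univ_two, add_comm]

lemma inner_quarterTurn_self (v : Plane) : ⟪v, quarterTurn v⟫ = 0 := by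
  simp [quarterTurn_apply, PiLp.inner_apply, Fin.sum_univ_two]
  ring

lemma quarterTurn_quarterTurn (v : Plane) : quarterTurn (quarterTurn v) = -v := by
  ext i; fin_cases i <;> simp [quarterTurn_apply]

/-- Hahn–Banach separates `x` from the open interior. The inequality passes to `S`, which lies in
the closure of its interior. -/
lemma exists_isOuterNormal {S : Set Plane} (hconv : Convex ℝ S)
    (hint : (interior S).Nonempty) {x : Plane} (hx : x ∈ frontier S) :
    ∃ ν, IsOuterNormal S x ν := by
  obtain ⟨f, hf⟩ := geometric_hahn_banach_open_point hconv.interior isOpen_interior hx.2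
  set m := (InnerProductSpace.toDual ℝ Plane).symm f with hm
  have hfm : ∀ y, f y = ⟪y, m⟫ := fun y => by
    rw [real_inner_comm, hm, InnerProductSpace.toDual_symm_apply]
  have hle : ∀ y ∈ S, ⟪y - x, m⟫ ≤ 0 := by
    have hcl : closure (interior S) ⊆ {y | ⟪y - x, m⟫ ≤ 0} := by
      refine closure_minimal (fun y hy => ?_) (isClosed_le (by fun_prop) continuous_const)
      have := hf y hy
      rw [hfm, hfm] at this
      simp only [mem_ofPred_eq, inner_sub_left]
      linarith
    intro y hy
    refine hcl ?_
    rw [hconv.closure_interior_eq_closure_of_nonempty_interior hint]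
    exact subset_closure hy
  have hm0 : m ≠ 0 := by
    intro h0
    obtain ⟨y, hy⟩ := hint
    have := hf y hy
    rw [hfm, hfm, h0, inner_zero_right, inner_zero_right] at this
    exact lt_irrefl _ this
  have hmn : 0 < ‖m‖ := norm_pos_iff.2 hm0
  refine ⟨‖m‖⁻¹ • m, ?_, fun y hy => ?_⟩
  · rw [norm_smul, norm_inv, norm_norm, inv_mul_cancel₀ hmn.ne']
  · rw [inner_smul_right]
    exact mul_nonpos_of_nonneg_of_nonpos (inv_nonneg.2 hmn.le) (hle y hy)

/-- The boundary of the convex body `S`, parametrized by arc length, with tangent `T`, outward normal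
`ν` and curvature `κ`. -/
structure BoundaryFrame (S : Set Plane) (L : ℝ) (γ T ν : ℝ → Plane) (κ : ℝ → ℝ) : Prop where
  convex : Convex ℝ S
  compact : IsCompact S
  int : (interior S).Nonempty
  L_pos : 0 < L
  deriv_curve : ∀ s, HasDerivAt γ (T s) s
  deriv_tangent : ∀ s, HasDerivAt T (-κ s • ν s) s
  deriv_normal : ∀ s, HasDerivAt ν (κ s • T s) s
  contDiff_curv : ContDiff ℝ 1 κ
  periodic : Function.Periodic γ L
  periodic_normal : Function.Periodic ν L
  periodic_curv : Function.Periodic κ L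
  curve_ne : ∀ a b, a < b → b < a + L → γ a ≠ γ b
  range_eq : range γ = frontier S
  norm_tangent : ∀ s, ‖T s‖ = 1
  norm_normal : ∀ s, ‖ν s‖ = 1
  orth : ∀ s, ⟪T s, ν s⟫ = 0
  support : ∀ s, ∀ y ∈ S, ⟪y - γ s, ν s⟫ ≤ 0

namespace BoundaryFrame

variable {S : Set Plane} {L : ℝ} {γ T ν : ℝ → Plane} {κ : ℝ → ℝ}

/-- Reversal negates the tangent and keeps the outward normal and the curvature, so each statement
about the forward side yields one about the backward side. -/
lemma reverse (F : BoundaryFrame S L γ T ν κ) :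
    BoundaryFrame S L (fun s => γ (-s)) (fun s => -T (-s)) (fun s => ν (-s)) (fun s => κ (-s)) where
  convex := F.convex
  compact := F.compact
  int := F.int
  L_pos := F.L_pos
  deriv_curve s := by
    have := (F.deriv_curve (-s)).scomp s (hasDerivAt_neg s)
    rwa [neg_one_smul] at this
  deriv_tangent s := by
    have := ((F.deriv_tangent (-s)).scomp s (hasDerivAt_neg s)).neg
    rwa [neg_one_smul, neg_neg] at this
  deriv_normal s := by
    have := (F.deriv_normal (-s)).scomp s (hasDerivAt_neg s)
    rwa [neg_one_smul, ← smul_neg] at this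
  contDiff_curv := F.contDiff_curv.comp contDiff_neg
  periodic s := by
    have := F.periodic (-(s + L)); simp only [neg_add, neg_add_cancel_right] at this ⊢
    exact this.symm
  periodic_normal s := by
    have := F.periodic_normal (-(s + L)); simp only [neg_add, neg_add_cancel_right] at this ⊢
    exact this.symm
  periodic_curv s := by
    have := F.periodic_curv (-(s + L)); simp only [neg_add, neg_add_cancel_right] at this ⊢
    exact this.symm
  curve_ne a b hab hba := (F.curve_ne (-b) (-a) (by linarith) (by linarith)).symm
  range_eq := by
    rw [← F.range_eq]
    exact (Equiv.neg ℝ).surjective.range_comp γ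
  norm_tangent s := by simpa using F.norm_tangent (-s)
  norm_normal s := F.norm_normal (-s)
  orth s := by simpa using F.orth (-s)
  support s := F.support (-s)

lemma continuous_curve (F : BoundaryFrame S L γ T ν κ) : Continuous γ :=
  continuous_iff_continuousAt.2 fun s => (F.deriv_curve s).continuousAt

lemma continuous_tangent (F : BoundaryFrame S L γ T ν κ) : Continuous T :=
  continuous_iff_continuousAt.2 fun s => (F.deriv_tangent s).continuousAt

lemma continuous_normal (F : BoundaryFrame S L γ T ν κ) : Continuous ν :=
  continuous_iff_continuousAt.2 fun s => (F.deriv_normal s).continuousAt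

lemma continuous_curv (F : BoundaryFrame S L γ T ν κ) : Continuous κ := F.contDiff_curv.continuous

lemma curve_mem_frontier (F : BoundaryFrame S L γ T ν κ) (s : ℝ) : γ s ∈ frontier S :=
  F.range_eq ▸ mem_range_self s

lemma curve_mem (F : BoundaryFrame S L γ T ν κ) (s : ℝ) : γ s ∈ S :=
  F.compact.isClosed.frontier_subset (F.curve_mem_frontier s)

lemma contactFrame (F : BoundaryFrame S L γ T ν κ) (s : ℝ) : ContactFrame S (γ s) (T s) (ν s) :=
  ⟨F.curve_mem s, F.norm_tangent s, F.norm_normal s, F.orth s, F.support s⟩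

lemma hasDerivAt_inner_curve (F : BoundaryFrame S L γ T ν κ) (c m : Plane) (s : ℝ) :
    HasDerivAt (fun u => ⟪γ u - c, m⟫) ⟪T s, m⟫ s := by
  simpa using ((F.deriv_curve s).sub_const c).inner ℝ (hasDerivAt_const s m)

lemma hasDerivAt_inner_tangent (F : BoundaryFrame S L γ T ν κ) (m : Plane) (s : ℝ) :
    HasDerivAt (fun u => ⟪T u, m⟫) (-κ s * ⟪ν s, m⟫) s := by
  simpa [inner_smul_left] using (F.deriv_tangent s).inner ℝ (hasDerivAt_const s m)

lemma hasDerivAt_inner_normal (F : BoundaryFrame S L γ T ν κ) (m : Plane) (s : ℝ) :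
    HasDerivAt (fun u => ⟪ν u, m⟫) (κ s * ⟪T s, m⟫) s := by
  simpa [inner_smul_left] using (F.deriv_normal s).inner ℝ (hasDerivAt_const s m)

/-- The outward unit normal at a boundary point is unique. -/
lemma eq_normal (F : BoundaryFrame S L γ T ν κ) {s : ℝ} {m : Plane}
    (hm : IsOuterNormal S (γ s) m) : m = ν s := by
  have hmax : IsLocalMax (fun u => ⟪γ u - γ s, m⟫) s :=
    Filter.Eventually.of_forall fun u => by simpa using hm.2 _ (F.curve_mem u)
  have hT : ⟪T s, m⟫ = 0 := hmax.hasDerivAt_eq_zero (F.hasDerivAt_inner_curve _ _ _)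
  have hexp := plane_expand (F.norm_tangent s) (F.norm_normal s) (F.orth s) m
  rw [real_inner_comm, hT, zero_smul, zero_add] at hexp
  have habs : |⟪m, ν s⟫| = 1 := by
    have := congrArg norm hexp
    rwa [hm.1, norm_smul, F.norm_normal, mul_one, Real.norm_eq_abs, eq_comm] at this
  rcases eq_or_eq_neg_of_abs_eq habs with h | h
  · rw [hexp, h, one_smul]
  · exfalso
    rw [h, neg_one_smul] at hexp
    have hne : ν s ≠ 0 := (F.contactFrame s).n_ne_zero
    refine not_forall_inner_eq F.int hne ⟪γ s, ν s⟫ fun y hy => ?_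
    have h1 := hm.2 y hy
    have h2 := F.support s y hy
    rw [hexp, inner_neg_right] at h1
    rw [inner_sub_left] at h1 h2
    linarith

/-- The height over the tangent line at `s` is at most 0, vanishes at `s` and has second derivative
`-κ s` there. If `κ s < 0`, the point would also be a local minimum, making the height locally
constant, a contradiction. -/
lemma curv_nonneg (F : BoundaryFrame S L γ T ν κ) (s : ℝ) : 0 ≤ κ s := by
  by_contra! hneg
  set f : ℝ → ℝ := fun u => ⟪γ u - γ s, ν s⟫ with hf
  have hd : deriv f = fun u => ⟪T u, ν s⟫ :=
    funext fun u => (F.hasDerivAt_inner_curve _ _ u).deriv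
  have hdd : deriv (deriv f) s = -κ s := by
    rw [hd, (F.hasDerivAt_inner_tangent _ s).deriv, real_inner_self_eq_norm_sq, F.norm_normal]
    ring
  have hmin : IsLocalMin f s := by
    refine isLocalMin_of_deriv_deriv_pos (by rw [hdd]; linarith) (by rw [hd]; exact F.orth s)
      (F.hasDerivAt_inner_curve _ _ s).continuousAt
  have hconst : f =ᶠ[nhds s] fun _ => 0 := by
    filter_upwards [hmin] with u hu
    refine le_antisymm (F.support s _ (F.curve_mem u)) ?_
    simpa [hf] using hu
  have := hconst.deriv.deriv_eq
  rw [hdd] at this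
  simp at this
  linarith

lemma curvature_eq (F : BoundaryFrame S L γ T ν κ) : curvature γ = κ := by
  ext s
  have h1 : deriv γ = T := funext fun u => (F.deriv_curve u).deriv
  rw [curvature, h1, (F.deriv_tangent s).deriv, norm_smul, F.norm_normal, norm_neg,
    Real.norm_of_nonneg (F.curv_nonneg s), mul_one]

end BoundaryFrame

/-- The moving frame attached to a choice `σ = ±1` of the side of the outward normal. -/
lemma boundaryFrame_of_sign {S : Set Plane} (hconv : Convex ℝ S) (hcomp : IsCompact S)
    (hint : (interior S).Nonempty) {L : ℝ} {γ : ℝ → Plane} (hγ : IsArcLengthBoundary S L γ)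
    {σ : ℝ} (hσ : σ ^ 2 = 1)
    (hsup : ∀ s, ∀ y ∈ S, ⟪y - γ s, σ • quarterTurn (deriv γ s)⟫ ≤ 0) :
    ∃ κ : ℝ → ℝ, BoundaryFrame S L γ (deriv γ) (fun s => σ • quarterTurn (deriv γ s)) κ := by
  set T := deriv γ with hT
  set ν : ℝ → Plane := fun s => σ • quarterTurn (T s) with hν
  have hT2 : ContDiff ℝ 2 T := by
    have h3 : ContDiff ℝ (2 + 1) γ := by
      simpa [show (2 : WithTop ℕ∞) + 1 = 3 by norm_num] using hγ.contDiff
    exact (contDiff_succ_iff_deriv.1 h3).2.2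
  have hT1 : ContDiff ℝ 1 (deriv T) := by
    have h3 : ContDiff ℝ (1 + 1) T := by
      simpa [show (1 : WithTop ℕ∞) + 1 = 2 by norm_num] using hT2
    exact (contDiff_succ_iff_deriv.1 h3).2.2
  have hdγ : ∀ s, HasDerivAt γ (T s) s := fun s =>
    (hγ.contDiff.differentiable (by norm_num) s).hasDerivAt
  have hdT : ∀ s, HasDerivAt T (deriv T s) s := fun s =>
    (hT2.differentiable (by norm_num) s).hasDerivAt
  have hσa : |σ| = 1 := by rw [← sq_eq_sq₀ (abs_nonneg _) zero_le_one, sq_abs, hσ, one_pow]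
  have hνn : ∀ s, ‖ν s‖ = 1 := fun s => by
    simp only [hν]
    rw [norm_smul, norm_quarterTurn, Real.norm_eq_abs, hσa, one_mul, hγ.unit_speed s]
  have horth : ∀ s, ⟪T s, ν s⟫ = 0 := fun s => by
    simp only [hν]
    rw [inner_smul_right, inner_quarterTurn_self, mul_zero]
  have hTT : ∀ s, ⟪deriv T s, T s⟫ = 0 := fun s => by
    have h1 : HasDerivAt (fun u => ⟪T u, T u⟫) (⟪T s, deriv T s⟫ + ⟪deriv T s, T s⟫) s :=
      (hdT s).inner ℝ (hdT s)
    have h2 : (fun u => ⟪T u, T u⟫) = fun _ => (1 : ℝ) := by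
      ext u; rw [real_inner_self_eq_norm_sq, hγ.unit_speed u, one_pow]
    rw [h2] at h1
    have := h1.unique (hasDerivAt_const s (1 : ℝ))
    rw [real_inner_comm] at this
    linarith
  have hdT' : ∀ s, deriv T s = -(-⟪deriv T s, ν s⟫) • ν s := fun s => by
    have := plane_expand (hγ.unit_speed s) (hνn s) (horth s) (deriv T s)
    rw [hTT s, zero_smul, zero_add] at this
    rw [neg_neg]; exact this
  have hTper : Function.Periodic T L := fun s => by
    rw [hT, ← deriv_comp_add_const]
    congr 1
    exact funext hγ.periodic
  have hdTper : Function.Periodic (deriv T) L := fun s => by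
    rw [← deriv_comp_add_const]
    congr 1
    exact funext hTper
  refine ⟨fun s => -⟪deriv T s, ν s⟫, hconv, hcomp, hint, hγ.length_pos, hdγ,
    fun s => hdT' s ▸ hdT s, ?_, ?_, hγ.periodic, ?_, ?_, ?_, hγ.range_eq, hγ.unit_speed, hνn,
    horth, hsup⟩
  · intro s
    have h1 : HasDerivAt ν (σ • quarterTurn (deriv T s)) s :=
      ((quarterTurn.hasFDerivAt.comp_hasDerivAt s (hdT s))).const_smul σ
    convert h1 using 1
    conv_rhs => rw [hdT' s]
    simp only [hν, map_smul, quarterTurn_quarterTurn]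
    rw [smul_smul, smul_smul, smul_neg, ← neg_smul]
    congr 1
    linear_combination (⟪deriv T s, σ • quarterTurn (T s)⟫) * (-1) * hσ.symm
  · refine ContDiff.neg (hT1.inner ℝ ?_)
    exact (quarterTurn.contDiff.comp (hT2.of_le one_le_two)).const_smul σ
  · intro s
    simp only [hν, hTper s]
  · intro s
    simp only [hν, hTper s, hdTper s]
  · intro a b hab hba heq
    have hL := hγ.length_pos
    -- Both parameters are moved into `[0, L)`; `b` may belong to the same period as `a` or to the
    -- next one.
    set k := ⌊a / L⌋ with hk
    have h1 : (k : ℝ) * L ≤ a := (le_div_iff₀ hL).1 (Int.floor_le _)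
    have h2 : a < (k + 1) * L := (div_lt_iff₀ hL).1 (Int.lt_floor_add_one _)
    have hper : ∀ (m : ℤ) (x : ℝ), γ (x - m * L) = γ x := fun m x => by
      simpa using hγ.periodic.sub_zsmul_eq (x := x) m
    rcases lt_or_ge b ((k + 1) * L) with hb | hb
    · have := hγ.injOn (show a - k * L ∈ Ico 0 L from ⟨by linarith, by linarith⟩)
        (show b - k * L ∈ Ico 0 L from ⟨by linarith, by linarith⟩)
        (by rw [hper, hper, heq])
      linarith
    · have h3 := hper (k + 1) b
      push_cast at h3
      have := hγ.injOn (show a - k * L ∈ Ico 0 L from ⟨by linarith, by linarith⟩)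
        (show b - (k + 1) * L ∈ Ico 0 L from ⟨by linarith, by linarith⟩)
        (by rw [hper, h3, heq])
      linarith

/-- The boundary of a planar convex body with `C³` boundary has a moving frame. -/
theorem exists_boundaryFrame {S : Set Plane} (hconv : Convex ℝ S) (hcomp : IsCompact S)
    (hint : (interior S).Nonempty) {L : ℝ} {γ : ℝ → Plane} (hγ : IsArcLengthBoundary S L γ) :
    ∃ T ν κ, BoundaryFrame S L γ T ν κ := by
  set n : ℝ → Plane := fun s => quarterTurn (deriv γ s) with hn
  have hnn : ∀ s, ‖n s‖ = 1 := fun s => by rw [hn]; simp only [norm_quarterTurn, hγ.unit_speed]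
  have horth : ∀ s, ⟪deriv γ s, n s⟫ = 0 := fun s => inner_quarterTurn_self _
  have hmem : ∀ s, γ s ∈ S := fun s =>
    hcomp.isClosed.frontier_subset (hγ.range_eq ▸ mem_range_self s)
  have hdγ : ∀ s, HasDerivAt γ (deriv γ s) s := fun s =>
    (hγ.contDiff.differentiable (by norm_num) s).hasDerivAt
  have hnc : Continuous n := quarterTurn.continuous.comp (hγ.contDiff.continuous_deriv (by norm_num))
  -- The parameters where the rotated tangent points outward, and in `B` those where it points
  -- inward. The two sets are closed and disjoint and cover the line, so by connectedness the side
  -- is the same everywhere.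
  set A : Set ℝ := {s | ∀ y ∈ S, ⟪y - γ s, n s⟫ ≤ 0} with hA
  set B : Set ℝ := {s | ∀ y ∈ S, 0 ≤ ⟪y - γ s, n s⟫} with hB
  have hγc := hγ.contDiff.continuous
  have hAc : IsClosed A := by
    simp only [hA, ofPred_forall]
    exact isClosed_iInter fun y => isClosed_iInter fun _ =>
      isClosed_le (by fun_prop) continuous_const
  have hBc : IsClosed B := by
    simp only [hB, ofPred_forall]
    exact isClosed_iInter fun y => isClosed_iInter fun _ =>
      isClosed_le continuous_const (by fun_prop)
  have hcover : ∀ s, s ∈ A ∨ s ∈ B := by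
    intro s
    obtain ⟨m, hm⟩ := exists_isOuterNormal hconv hint (x := γ s) (hγ.range_eq ▸ mem_range_self s)
    have hmax : IsLocalMax (fun u => ⟪γ u - γ s, m⟫) s :=
      Filter.Eventually.of_forall fun u => by simpa using hm.2 _ (hmem u)
    have hT : ⟪deriv γ s, m⟫ = 0 := hmax.hasDerivAt_eq_zero
      (by simpa using ((hdγ s).sub_const (γ s)).inner ℝ (hasDerivAt_const s m))
    have hexp := plane_expand (hγ.unit_speed s) (hnn s) (horth s) m
    rw [real_inner_comm, hT, zero_smul, zero_add] at hexp
    have habs : |⟪m, n s⟫| = 1 := by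
      have := congrArg norm hexp
      rwa [hm.1, norm_smul, hnn, mul_one, Real.norm_eq_abs, eq_comm] at this
    rcases eq_or_eq_neg_of_abs_eq habs with h | h
    · rw [h, one_smul] at hexp
      exact Or.inl fun y hy => hexp ▸ hm.2 y hy
    · rw [h, neg_one_smul] at hexp
      refine Or.inr fun y hy => ?_
      have := hm.2 y hy
      rw [hexp, inner_neg_right] at this
      linarith
  have hdisj : ∀ s, s ∈ A → s ∉ B := by
    intro s h1 h2
    have hne : n s ≠ 0 := fun h0 => by simpa [h0] using hnn s
    refine not_forall_inner_eq hint hne ⟪γ s, n s⟫ fun y hy => ?_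
    have h1 := h1 y hy
    have h2 := h2 y hy
    rw [inner_sub_left] at h1 h2
    linarith
  have hAo : IsOpen A := by
    have : A = Bᶜ := by
      ext s
      exact ⟨hdisj s, fun h => (hcover s).resolve_right h⟩
    rw [this]; exact hBc.isOpen_compl
  rcases isClopen_iff.1 ⟨hAc, hAo⟩ with h | h
  · obtain ⟨κ, hκ⟩ := boundaryFrame_of_sign hconv hcomp hint hγ (σ := -1) (by norm_num)
      (fun s y hy => by
        have hs : s ∈ B := (hcover s).resolve_left (by rw [h]; exact notMem_empty s)
        rw [neg_one_smul, inner_neg_right]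
        linarith [hs y hy])
    exact ⟨_, _, κ, hκ⟩
  · obtain ⟨κ, hκ⟩ := boundaryFrame_of_sign hconv hcomp hint hγ (σ := 1) (by norm_num)
      (fun s y hy => by
        have hs : s ∈ A := by rw [h]; exact mem_univ s
        rw [one_smul]
        exact hs y hy)
    exact ⟨_, _, κ, hκ⟩

/-! ### Flat arcs and supporting lines -/

namespace BoundaryFrame

variable {S : Set Plane} {L : ℝ} {γ T ν : ℝ → Plane} {κ : ℝ → ℝ}

lemma injOn_Icc (F : BoundaryFrame S L γ T ν κ) {a b : ℝ} (h : b < a + L) :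
    InjOn γ (Icc a b) := by
  intro u hu v hv huv
  rcases lt_trichotomy u v with hlt | heq | hlt
  · exact absurd huv (F.curve_ne u v hlt (by linarith [hu.1, hv.2]))
  · exact heq
  · exact absurd huv.symm (F.curve_ne v u hlt (by linarith [hv.1, hu.2]))

lemma exists_mem_Ico (F : BoundaryFrame S L γ T ν κ) {z : Plane} (hz : z ∈ frontier S) (a : ℝ) :
    ∃ u ∈ Ico a (a + L), γ u = z := by
  rw [← F.range_eq] at hz
  obtain ⟨v, rfl⟩ := hz
  obtain ⟨u, hu, huv⟩ := F.periodic.exists_mem_Ico F.L_pos v a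
  exact ⟨u, hu, huv.symm⟩

/-- An injective arc that covers the open segment between its end points lies on this segment. -/
lemma arc_subset_segment (F : BoundaryFrame S L γ T ν κ) {a b : ℝ} (hab : a ≤ b) (hba : b < a + L)
    (hseg : openSegment ℝ (γ a) (γ b) ⊆ γ '' Icc a b) :
    ∀ u ∈ Icc a b, γ u ∈ segment ℝ (γ a) (γ b) := by
  set f : Icc a b → Plane := fun u => γ u with hf
  have hfc : Continuous f := F.continuous_curve.comp continuous_subtype_val
  have hfi : Function.Injective f := fun u v huv => Subtype.ext (F.injOn_Icc hba u.2 v.2 huv)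
  have hemb := hfc.isClosedEmbedding hfi
  have hsub : segment ℝ (γ a) (γ b) ⊆ range f := by
    rw [← insert_endpoints_openSegment, insert_subset_iff, insert_subset_iff]
    refine ⟨⟨⟨a, left_mem_Icc.2 hab⟩, rfl⟩, ⟨⟨b, right_mem_Icc.2 hab⟩, rfl⟩, fun z hz => ?_⟩
    obtain ⟨u, hu, rfl⟩ := hseg hz
    exact ⟨⟨u, hu⟩, rfl⟩
  -- The parameters mapped into the segment form a preconnected set, because `f` is an embedding
  -- whose range contains the segment. This set contains both ends, hence the whole interval.
  have hP : IsPreconnected (f ⁻¹' segment ℝ (γ a) (γ b)) := by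
    rw [← hemb.isInducing.isPreconnected_image, image_preimage_eq_of_subset hsub]
    exact (convex_segment _ _).isPreconnected
  have hP' := (hP.image _ continuous_subtype_val.continuousOn).Icc_subset
    ⟨⟨a, left_mem_Icc.2 hab⟩, left_mem_segment ℝ _ _, rfl⟩
    ⟨⟨b, right_mem_Icc.2 hab⟩, right_mem_segment ℝ _ _, rfl⟩
  intro u hu
  obtain ⟨v, hv, hvu⟩ := hP' hu
  rw [← hvu]
  exact hv

/-- Differentiating twice gives `⟪T, m⟫ = 0` and `κ * ⟪ν, m⟫ = 0`, and the two inner products cannot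
both vanish. -/
lemma curv_eq_zero_of_inner_eq_zero (F : BoundaryFrame S L γ T ν κ) {a b : ℝ} (hab : a < b)
    {c m : Plane} (hm : m ≠ 0) (h : ∀ u ∈ Icc a b, ⟪γ u - c, m⟫ = 0) :
    ∀ u ∈ Icc a b, κ u = 0 := by
  have hT : ∀ u ∈ Ioo a b, ⟪T u, m⟫ = 0 := by
    intro u hu
    have h1 : (fun u => ⟪γ u - c, m⟫) =ᶠ[nhds u] fun _ => 0 := by
      filter_upwards [Icc_mem_nhds hu.1 hu.2] with v hv using h v hv
    exact ((F.hasDerivAt_inner_curve c m u).congr_of_eventuallyEq h1.symm).unique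
      (hasDerivAt_const u (0 : ℝ))
  have hκ : ∀ u ∈ Ioo a b, κ u = 0 := by
    intro u hu
    have h1 : (fun u => ⟪T u, m⟫) =ᶠ[nhds u] fun _ => 0 := by
      filter_upwards [Ioo_mem_nhds hu.1 hu.2] with v hv using hT v hv
    have h2 := ((F.hasDerivAt_inner_tangent m u).congr_of_eventuallyEq h1.symm).unique
      (hasDerivAt_const u (0 : ℝ))
    rcases mul_eq_zero.1 h2 with h3 | h3
    · linarith
    · exfalso
      have := plane_expand (F.norm_tangent u) (F.norm_normal u) (F.orth u) m
      rw [real_inner_comm, hT u hu, real_inner_comm, h3] at this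
      exact hm (by simpa using this)
  have hcl : closure (Ioo a b) ⊆ {u | κ u = 0} :=
    closure_minimal hκ (isClosed_eq F.continuous_curv continuous_const)
  rw [closure_Ioo hab.ne] at hcl
  exact hcl

/-- If the supporting line at one boundary point contains another one, the boundary is flat on one of
the two arcs between them. -/
theorem flat_of_common_support (F : BoundaryFrame S L γ T ν κ) {a b : ℝ} (hab : a < b)
    (hba : b < a + L) (h : ⟪γ b - γ a, ν a⟫ = 0) :
    (∀ u ∈ Icc a b, κ u = 0) ∨ ∀ u ∈ Icc b (a + L), κ u = 0 := by
  have hν : ν a ≠ 0 := (F.contactFrame a).n_ne_zero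
  have hne := F.curve_ne a b hab hba
  have hline : ∀ z ∈ segment ℝ (γ a) (γ b), ⟪z - γ a, ν a⟫ = 0 := by
    rintro z ⟨p, q, hp, hq, hpq, rfl⟩
    have : p • γ a + q • γ b - γ a = q • (γ b - γ a) := by
      rw [eq_sub_of_add_eq hpq]; module
    rw [this, inner_smul_left, h, mul_zero]
  have hfr : openSegment ℝ (γ a) (γ b) ⊆ frontier S := by
    intro z hz
    have hz' := openSegment_subset_segment ℝ _ _ hz
    refine mem_frontier_of_support (F.convex.segment_subset (F.curve_mem a) (F.curve_mem b) hz') hν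
      fun y hy => ?_
    have h1 := F.support a y hy
    have h2 := hline z hz'
    rw [inner_sub_left] at *
    linarith
  have hends : ∀ z ∈ openSegment ℝ (γ a) (γ b), z ≠ γ a ∧ z ≠ γ b := by
    intro z hz
    constructor
    · rintro rfl
      exact hne (left_mem_openSegment_iff.1 hz)
    · rintro rfl
      exact hne (right_mem_openSegment_iff.1 hz)
  have hper : γ (a + L) = γ a := F.periodic a
  have hcompact : ∀ x y, IsClosed (γ '' Icc x y) := fun x y =>
    (isCompact_Icc.image F.continuous_curve).isClosed
  have hcover : openSegment ℝ (γ a) (γ b) ⊆ γ '' Icc a b ∪ γ '' Icc b (a + L) := by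
    intro z hz
    obtain ⟨u, hu, rfl⟩ := F.exists_mem_Ico (hfr hz) a
    rcases le_total u b with hub | hub
    · exact Or.inl ⟨u, ⟨hu.1, hub⟩, rfl⟩
    · exact Or.inr ⟨u, ⟨hub, hu.2.le⟩, rfl⟩
  have hdisj : openSegment ℝ (γ a) (γ b) ∩ (γ '' Icc a b ∩ γ '' Icc b (a + L)) = ∅ := by
    rw [eq_empty_iff_forall_notMem]
    rintro z ⟨hz, ⟨u, hu, rfl⟩, v, hv, hvu⟩
    obtain ⟨hza, hzb⟩ := hends _ hz
    have hub : u < b := lt_of_le_of_ne hu.2 fun h => hzb (h ▸ rfl)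
    have hau : a < u := lt_of_le_of_ne hu.1 fun h => hza (h ▸ rfl)
    exact F.curve_ne u v (hub.trans_le hv.1) (by linarith [hv.2]) hvu.symm
  have hpre : IsPreconnected (openSegment ℝ (γ a) (γ b)) := (convex_openSegment _ _).isPreconnected
  -- The open segment lies in the boundary and avoids the points common to the two closed arcs.
  -- Being connected, it lies in one of them.
  rcases isPreconnected_iff_subset_of_disjoint_closed.1 hpre _ _ (hcompact _ _) (hcompact _ _)
    hcover hdisj with hs | hs
  · left
    exact F.curv_eq_zero_of_inner_eq_zero hab hν fun u hu =>
      hline _ (F.arc_subset_segment hab.le hba hs u hu)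
  · right
    refine F.curv_eq_zero_of_inner_eq_zero hba (c := γ a) hν fun u hu => hline _ ?_
    have hs' : openSegment ℝ (γ b) (γ (a + L)) ⊆ γ '' Icc b (a + L) := by
      rwa [hper, openSegment_symm]
    have := F.arc_subset_segment hba.le (by linarith) hs' u hu
    rwa [hper, segment_symm] at this

/-- Where the curvature is positive, the supporting line touches `S` only once. -/
lemma inner_neg_of_curv_ne_zero (F : BoundaryFrame S L γ T ν κ) {a b : ℝ} (hκ : κ a ≠ 0)
    (hab : a < b) (hba : b < a + L) : ⟪γ b - γ a, ν a⟫ < 0 := by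
  refine lt_of_le_of_ne (F.support a _ (F.curve_mem b)) fun h => ?_
  rcases F.flat_of_common_support hab hba h with h | h
  · exact hκ (h a (left_mem_Icc.2 hab.le))
  · have := h (a + L) (right_mem_Icc.2 hba.le)
    rw [F.periodic_curv] at this
    exact hκ this

/-- With zero curvature the tangent would be constant and the curve a straight line, which is not
periodic. -/
lemma exists_curv_ne_zero (F : BoundaryFrame S L γ T ν κ) : ∃ u, κ u ≠ 0 := by
  by_contra! h
  have hT : ∀ u, T u = T 0 := fun u =>
    is_const_of_deriv_eq_zero (fun x => (F.deriv_tangent x).differentiableAt)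
      (fun x => by rw [(F.deriv_tangent x).deriv, h x, neg_zero, zero_smul]) u 0
  have hd : ∀ u, HasDerivAt (fun u => ⟪γ u - γ 0, T 0⟫ - u) 0 u := fun u => by
    have := (F.hasDerivAt_inner_curve (γ 0) (T 0) u).sub (hasDerivAt_id u)
    rwa [hT u, real_inner_self_eq_norm_sq, F.norm_tangent, one_pow, sub_self] at this
  have := is_const_of_deriv_eq_zero (fun x => (hd x).differentiableAt) (fun x => (hd x).deriv) L 0
  have hper : γ L = γ 0 := by simpa using F.periodic 0
  rw [hper] at this
  have hL := F.L_pos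
  simp at this
  linarith

/-- A flat arc of the boundary lies in the flat piece of each of its points. -/
lemma mem_flatPiece_of_curv_eq_zero (F : BoundaryFrame S L γ T ν κ) {a b : ℝ}
    (h : ∀ u ∈ uIcc a b, κ u = 0) : γ b ∈ flatPiece S (γ a) := by
  have hT : ∀ u ∈ uIcc a b, T u = T a := by
    intro u hu
    have hb : ‖T u - T a‖ ≤ 0 * ‖u - a‖ :=
      (convex_uIcc a b).norm_image_sub_le_of_norm_hasDerivWithin_le
        (fun x _ => (F.deriv_tangent x).hasDerivWithinAt)
        (fun x hx => by rw [h x hx]; simp) left_mem_uIcc hu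
    rw [zero_mul] at hb
    exact sub_eq_zero.1 (norm_le_zero_iff.1 hb)
  have hγ : ∀ u ∈ uIcc a b, γ u = γ a + (u - a) • T a := by
    intro u hu
    have hd : ∀ x, HasDerivAt (fun x => γ x - (x - a) • T a) (T x - (1 : ℝ) • T a) x := fun x =>
      (F.deriv_curve x).sub (((hasDerivAt_id x).sub_const a).smul_const (T a))
    have hb : ‖(γ u - (u - a) • T a) - (γ a - (a - a) • T a)‖ ≤ 0 * ‖u - a‖ :=
      (convex_uIcc a b).norm_image_sub_le_of_norm_hasDerivWithin_le
        (f := fun x => γ x - (x - a) • T a)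
        (fun x _ => (hd x).hasDerivWithinAt)
        (fun x hx => by rw [hT x hx]; simp) left_mem_uIcc hu
    rw [zero_mul] at hb
    have := sub_eq_zero.1 (norm_le_zero_iff.1 hb)
    rw [sub_self, zero_smul, sub_zero] at this
    exact eq_add_of_sub_eq this
  show segment ℝ (γ a) (γ b) ⊆ frontier S
  rw [segment_eq_image']
  rintro _ ⟨θ, hθ, rfl⟩
  have hmem : a + θ * (b - a) ∈ uIcc a b := by
    have : a + θ * (b - a) ∈ (fun θ : ℝ => a + θ • (b - a)) '' Icc 0 1 := ⟨θ, hθ, rfl⟩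
    rwa [← segment_eq_image', segment_eq_uIcc] at this
  have : γ a + θ • (γ b - γ a) = γ (a + θ * (b - a)) := by
    rw [hγ b right_mem_uIcc, hγ _ hmem]; module
  simp only
  rw [this]
  exact F.curve_mem_frontier _

/-- The outward normal turns uniformly along an arc of constant curvature. -/
lemma normal_of_const_curv (F : BoundaryFrame S L γ T ν κ) {s η k : ℝ}
    (hκ : ∀ u ∈ Ioo (s - η) (s + η), κ u = k) {u : ℝ} (hu : |u| < η) :
    ν (s + u) = Real.sin (k * u) • T s + Real.cos (k * u) • ν s := by
  have hI : ∀ v ∈ Ioo (-η) η, κ (s + v) = k := fun v hv =>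
    hκ _ ⟨by linarith [hv.1], by linarith [hv.2]⟩
  have hu' : u ∈ Ioo (-η) η := abs_lt.1 hu
  have h0 : (0 : ℝ) ∈ Ioo (-η) η := abs_lt.1 (by rw [abs_zero]; exact (abs_nonneg u).trans_lt hu)
  have hT : ∀ v, HasDerivAt (fun v => T (s + v)) (-κ (s + v) • ν (s + v)) v := fun v => by
    simpa using (F.deriv_tangent (s + v)).comp_const_add s v
  have hν : ∀ v, HasDerivAt (fun v => ν (s + v)) (κ (s + v) • T (s + v)) v := fun v => by
    simpa using (F.deriv_normal (s + v)).comp_const_add s v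
  have hcos : ∀ v, HasDerivAt (fun v => Real.cos (k * v)) (-Real.sin (k * v) * (k * 1)) v := fun v =>
    ((hasDerivAt_id v).const_mul k).cos
  have hsin : ∀ v, HasDerivAt (fun v => Real.sin (k * v)) (Real.cos (k * v) * (k * 1)) v := fun v =>
    ((hasDerivAt_id v).const_mul k).sin
  -- The frame rotated back by the angle `k * u` has zero derivative on the arc.
  have hA : Real.cos (k * u) • T (s + u) + Real.sin (k * u) • ν (s + u) = T s := by
    have hb := (convex_Ioo (-η) η).norm_image_sub_le_of_norm_hasDerivWithin_le (C := 0)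
      (f := fun v => Real.cos (k * v) • T (s + v) + Real.sin (k * v) • ν (s + v))
      (fun x _ => (((hcos x).smul (hT x)).add ((hsin x).smul (hν x))).hasDerivWithinAt)
      (fun x hx => by
        rw [hI x hx, norm_le_zero_iff]; module) h0 hu'
    rw [zero_mul] at hb
    simpa using sub_eq_zero.1 (norm_le_zero_iff.1 hb)
  have hB : -Real.sin (k * u) • T (s + u) + Real.cos (k * u) • ν (s + u) = ν s := by
    have hb := (convex_Ioo (-η) η).norm_image_sub_le_of_norm_hasDerivWithin_le (C := 0)
      (f := fun v => -Real.sin (k * v) • T (s + v) + Real.cos (k * v) • ν (s + v))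
      (fun x _ => (((hsin x).neg.smul (hT x)).add ((hcos x).smul (hν x))).hasDerivWithinAt)
      (fun x hx => by
        rw [hI x hx, norm_le_zero_iff, Pi.neg_apply]; module) h0 hu'
    rw [zero_mul] at hb
    simpa using sub_eq_zero.1 (norm_le_zero_iff.1 hb)
  rw [← hA, ← hB]
  have h1 := Real.sin_sq_add_cos_sq (k * u)
  have : ν (s + u) = (Real.sin (k * u) ^ 2 + Real.cos (k * u) ^ 2) • ν (s + u) := by
    rw [h1, one_smul]
  refine this.trans ?_
  module

/-- A boundary arc of constant curvature `k ≠ 0` is circular. -/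
lemma curve_of_const_curv (F : BoundaryFrame S L γ T ν κ) {s η k : ℝ} (hk : k ≠ 0)
    (hκ : ∀ u ∈ Ioo (s - η) (s + η), κ u = k) {u : ℝ} (hu : |u| < η) :
    γ (s + u) - γ s = (Real.sin (k * u) / k) • T s + ((Real.cos (k * u) - 1) / k) • ν s := by
  have hu' : u ∈ Ioo (-η) η := abs_lt.1 hu
  have h0 : (0 : ℝ) ∈ Ioo (-η) η := abs_lt.1 (by rw [abs_zero]; exact (abs_nonneg u).trans_lt hu)
  -- On the arc `ν - k • γ` is constant; it is `-k` times the centre of the circle.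
  have hd : ∀ x, HasDerivAt (fun v => ν (s + v) - k • γ (s + v))
      (κ (s + x) • T (s + x) - k • T (s + x)) x := fun x =>
    ((F.deriv_normal (s + x)).comp_const_add s x).sub
      (((F.deriv_curve (s + x)).comp_const_add s x).const_smul k)
  have hb := (convex_Ioo (-η) η).norm_image_sub_le_of_norm_hasDerivWithin_le (C := 0)
      (f := fun v => ν (s + v) - k • γ (s + v)) (fun x _ => (hd x).hasDerivWithinAt)
      (fun x hx => by
        rw [hκ (s + x) ⟨by linarith [hx.1], by linarith [hx.2]⟩]; simp) h0 hu'
  rw [zero_mul] at hb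
  have h1 := sub_eq_zero.1 (norm_le_zero_iff.1 hb)
  simp only [add_zero] at h1
  rw [F.normal_of_const_curv hκ hu] at h1
  have h2 : k • (γ (s + u) - γ s) = Real.sin (k * u) • T s + (Real.cos (k * u) - 1) • ν s := by
    rw [smul_sub, sub_smul, one_smul, ← sub_eq_zero]
    rw [← sub_eq_zero] at h1
    rw [← neg_eq_zero, ← h1]
    module
  rw [div_eq_inv_mul, div_eq_inv_mul, mul_smul, mul_smul, ← smul_add, ← h2, smul_smul,
    inv_mul_cancel₀ hk, one_smul]

end BoundaryFrame

/-! ### Behaviour of the slopes close to the boundary -/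

open Filter Topology Asymptotics in
lemma isLittleO_pow_succ_of_deriv {f f' : ℝ → ℝ} (hf : ∀ u, HasDerivAt f (f' u) u) (h0 : f 0 = 0)
    {n : ℕ} (h : f' =o[𝓝 0] fun u => u ^ n) : f =o[𝓝 0] fun u => u ^ (n + 1) := by
  rw [isLittleO_iff] at h ⊢
  intro c hc
  obtain ⟨r, hr, hball⟩ := Metric.eventually_nhds_iff.1 (h hc)
  refine Metric.eventually_nhds_iff.2 ⟨r, hr, fun u hu => ?_⟩
  have hb : ‖f u - f 0‖ ≤ (c * |u| ^ n) * ‖u - 0‖ := by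
    refine (convex_uIcc 0 u).norm_image_sub_le_of_norm_hasDerivWithin_le
      (fun x _ => (hf x).hasDerivWithinAt) (fun x hx => ?_) left_mem_uIcc right_mem_uIcc
    have hxu : |x| ≤ |u| := by simpa using abs_sub_left_of_mem_uIcc hx
    have hx' := hball (y := x) (by
      rw [Real.dist_eq, sub_zero] at hu ⊢
      exact hxu.trans_lt hu)
    rw [norm_pow, Real.norm_eq_abs x] at hx'
    exact hx'.trans (by gcongr)
  rw [h0, sub_zero, sub_zero] at hb
  rw [norm_pow, pow_succ, ← mul_assoc]
  exact hb

open Filter Topology Asymptotics in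
/-- Third order expansion of the even part of a function at a point. -/
lemma isLittleO_even_part {f f₁ f₂ : ℝ → ℝ} (h1 : ∀ u, HasDerivAt f (f₁ u) u)
    (h2 : ∀ u, HasDerivAt f₁ (f₂ u) u) {s c : ℝ} (h3 : HasDerivAt f₂ c s) (hs : f s = 0)
    (hs2 : f₂ s = 0) : (fun u => f (s + u) + f (s - u)) =o[𝓝 0] fun u => u ^ 3 := by
  have d0 : ∀ u, HasDerivAt (fun u => f (s + u) + f (s - u)) (f₁ (s + u) - f₁ (s - u)) u := fun u =>
    ((h1 (s + u)).comp_const_add s u).add ((h1 (s - u)).comp_const_sub s u)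
  have d1 : ∀ u, HasDerivAt (fun u => f₁ (s + u) - f₁ (s - u)) (f₂ (s + u) + f₂ (s - u)) u := by
    intro u
    have := ((h2 (s + u)).comp_const_add s u).sub ((h2 (s - u)).comp_const_sub s u)
    rwa [sub_neg_eq_add] at this
  have d2 : HasDerivAt (fun u => f₂ (s + u) + f₂ (s - u)) (c - c) 0 :=
    (HasDerivAt.comp_const_add s 0 (by rwa [add_zero])).add
      (HasDerivAt.comp_const_sub s 0 (by rwa [sub_zero]))
  have o2 : (fun u => f₂ (s + u) + f₂ (s - u)) =o[𝓝 0] fun u => u ^ 1 := by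
    have := hasDerivAt_iff_isLittleO.1 d2
    simpa [hs2] using this
  exact isLittleO_pow_succ_of_deriv d0 (by simp [hs])
    (isLittleO_pow_succ_of_deriv d1 (by simp) o2)

open Filter Topology Asymptotics in
/-- Third order expansion of the odd part of a function at a point. -/
lemma isLittleO_odd_part {f f₁ f₂ : ℝ → ℝ} (h1 : ∀ u, HasDerivAt f (f₁ u) u)
    (h2 : ∀ u, HasDerivAt f₁ (f₂ u) u) {s c : ℝ} (h3 : HasDerivAt f₂ c s) (hs1 : f₁ s = 0) :
    (fun u => f (s + u) - f (s - u) - c / 3 * u ^ 3) =o[𝓝 0] fun u => u ^ 3 := by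
  have d0 : ∀ u, HasDerivAt (fun u => f (s + u) - f (s - u) - c / 3 * u ^ 3)
      (f₁ (s + u) + f₁ (s - u) - c * u ^ 2) u := by
    intro u
    have := (((h1 (s + u)).comp_const_add s u).sub ((h1 (s - u)).comp_const_sub s u)).sub
      ((hasDerivAt_pow 3 u).const_mul (c / 3))
    refine this.congr_deriv ?_
    norm_num; ring
  have d1 : ∀ u, HasDerivAt (fun u => f₁ (s + u) + f₁ (s - u) - c * u ^ 2)
      (f₂ (s + u) - f₂ (s - u) - 2 * c * u) u := by
    intro u
    have := (((h2 (s + u)).comp_const_add s u).add ((h2 (s - u)).comp_const_sub s u)).sub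
      ((hasDerivAt_pow 2 u).const_mul c)
    refine this.congr_deriv ?_
    norm_num; ring
  have d2 : HasDerivAt (fun u => f₂ (s + u) - f₂ (s - u) - 2 * c * u) 0 0 := by
    have := ((HasDerivAt.comp_const_add s 0 (f := f₂) (f' := c) (by rwa [add_zero])).sub
      (HasDerivAt.comp_const_sub s 0 (f := f₂) (f' := c) (by rwa [sub_zero]))).sub
      ((hasDerivAt_id (0 : ℝ)).const_mul (2 * c))
    refine this.congr_deriv ?_
    ring
  have o2 : (fun u => f₂ (s + u) - f₂ (s - u) - 2 * c * u) =o[𝓝 0] fun u => u ^ 1 := by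
    have := hasDerivAt_iff_isLittleO.1 d2
    simpa using this
  exact isLittleO_pow_succ_of_deriv d0 (by simp)
    (isLittleO_pow_succ_of_deriv d1 (by simp [hs1]) o2)

namespace BoundaryFrame

variable {S : Set Plane} {L : ℝ} {γ T ν : ℝ → Plane} {κ : ℝ → ℝ}

lemma norm_curve_sub_le (F : BoundaryFrame S L γ T ν κ) (s u : ℝ) : ‖γ (s + u) - γ s‖ ≤ |u| := by
  have := convex_univ.norm_image_sub_le_of_norm_hasDerivWithin_le (C := 1) (x := s) (y := s + u)
    (fun x _ => (F.deriv_curve x).hasDerivWithinAt)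
    (fun x _ => (F.norm_tangent x).le) (mem_univ _) (mem_univ _)
  simpa using this

lemma abs_inner_curve_le (F : BoundaryFrame S L γ T ν κ) (s u : ℝ) {m : Plane} (hm : ‖m‖ = 1) :
    |⟪γ (s + u) - γ s, m⟫| ≤ |u| :=
  (abs_real_inner_le_norm _ _).trans (by rw [hm, mul_one]; exact F.norm_curve_sub_le s u)

open Filter Topology Asymptotics in
lemma eventually_abs_inner_tangent_sub_le (F : BoundaryFrame S L γ T ν κ) (s : ℝ) :
    ∀ᶠ u in 𝓝 (0 : ℝ), |⟪γ (s + u) - γ s, T s⟫ - u| ≤ |u| / 2 := by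
  have h1 : HasDerivAt (fun u => ⟪γ (s + u) - γ s, T s⟫) (1 : ℝ) 0 := by
    have := (F.hasDerivAt_inner_curve (γ s) (T s) (s + 0)).comp_const_add s 0
    rwa [add_zero, real_inner_self_eq_norm_sq, F.norm_tangent, one_pow] at this
  have := (isLittleO_iff.1 (hasDerivAt_iff_isLittleO.1 h1)) (c := 1 / 2) (by norm_num)
  filter_upwards [this] with u hu
  simp at hu
  linarith

-- The depth is `κ s / 2 * u ^ 2 + o(u ^ 2)`; the summand 1 absorbs the error.
open Filter Topology Asymptotics in
lemma eventually_depth_le (F : BoundaryFrame S L γ T ν κ) (s : ℝ) :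
    ∀ᶠ u in 𝓝 (0 : ℝ), -⟪γ (s + u) - γ s, ν s⟫ ≤ (κ s / 2 + 1) * u ^ 2 := by
  have d0 : ∀ u, HasDerivAt (fun u => ⟪γ (s + u) - γ s, ν s⟫ + κ s / 2 * u ^ 2)
      (⟪T (s + u), ν s⟫ + κ s * u) u := by
    intro u
    have := ((F.hasDerivAt_inner_curve (γ s) (ν s) (s + u)).comp_const_add s u).add
      ((hasDerivAt_pow 2 u).const_mul (κ s / 2))
    refine this.congr_deriv ?_
    norm_num; ring
  have d1 : HasDerivAt (fun u => ⟪T (s + u), ν s⟫ + κ s * u) 0 0 := by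
    have := ((F.hasDerivAt_inner_tangent (ν s) (s + 0)).comp_const_add s 0).add
      ((hasDerivAt_id (0 : ℝ)).const_mul (κ s))
    refine this.congr_deriv ?_
    rw [add_zero, real_inner_self_eq_norm_sq, F.norm_normal]
    ring
  have o1 : (fun u => ⟪T (s + u), ν s⟫ + κ s * u) =o[𝓝 0] fun u => u ^ 1 := by
    have := hasDerivAt_iff_isLittleO.1 d1
    simpa [F.orth s] using this
  have o0 := isLittleO_pow_succ_of_deriv d0 (by simp) o1
  filter_upwards [isLittleO_iff.1 o0 one_pos] with u hu
  rw [Real.norm_eq_abs, Real.norm_eq_abs, one_mul,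
    abs_of_nonneg (show 0 ≤ u ^ (1 + 1) from even_two.pow_nonneg u)] at hu
  have := (abs_le.1 hu).1
  simp only [Nat.reduceAdd] at this
  linarith

open Filter Topology Asymptotics in
/-- Where the curvature increases, the boundary looks flatter in the backward direction. -/
lemma eventually_slope_lt (F : BoundaryFrame S L γ T ν κ) {s : ℝ} (hκ' : 0 < deriv κ s) :
    ∀ᶠ u in 𝓝 (0 : ℝ), 0 < u → ∀ t, 0 < t → t ≤ u →
      ⟪γ (s + u) - γ s, T s⟫ / (t - ⟪γ (s + u) - γ s, ν s⟫) <
        ⟪γ (s + -u) - γ s, -T s⟫ / (t - ⟪γ (s + -u) - γ s, ν s⟫) := by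
  have hκd : HasDerivAt κ (deriv κ s) s :=
    (F.contDiff_curv.differentiable (by norm_num) s).hasDerivAt
  have ex := isLittleO_even_part (F.hasDerivAt_inner_curve (γ s) (T s))
    (F.hasDerivAt_inner_tangent (T s))
    (hκd.neg.mul (F.hasDerivAt_inner_normal (T s) s)) (by simp)
    (by rw [real_inner_comm, F.orth s, mul_zero])
  have ey := isLittleO_odd_part (F.hasDerivAt_inner_curve (γ s) (ν s))
    (F.hasDerivAt_inner_tangent (ν s))
    (hκd.neg.mul (F.hasDerivAt_inner_normal (ν s) s)) (F.orth s)
  have hc : -deriv κ s * ⟪ν s, ν s⟫ + (-κ) s * (κ s * ⟪T s, ν s⟫) = -deriv κ s := by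
    rw [F.orth s, real_inner_self_eq_norm_sq, F.norm_normal]; ring
  rw [hc] at ey
  set k := deriv κ s with hk
  -- After cross-multiplication the tangential error is at most `k / 48 * u ^ 3` times a depth of at
  -- most `2 * u`, that is `k / 24 * u ^ 4`. The gain from the depth difference is at least `u / 2`
  -- times `k / 6 * u ^ 3`, that is `k / 12 * u ^ 4`.
  have ex' := isLittleO_iff.1 ex (c := k / 48) (by positivity)
  have ey' := isLittleO_iff.1 ey (c := k / 6) (by positivity)
  have hx := (continuous_neg.tendsto' (0 : ℝ) 0 neg_zero).eventually
    (F.eventually_abs_inner_tangent_sub_le s)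
  filter_upwards [ex', ey', hx] with u h1 h2 h3 hu t ht htu
  rw [Real.norm_eq_abs, Real.norm_eq_abs, abs_of_pos (pow_pos hu 3)] at h1 h2
  rw [← sub_eq_add_neg, abs_neg, abs_of_pos hu] at h3
  rw [← sub_eq_add_neg, inner_neg_right]
  have hyp := F.support s _ (F.curve_mem (s + u))
  have hym := F.support s _ (F.curve_mem (s - u))
  have hyb := F.abs_inner_curve_le s (-u) (F.norm_normal s)
  rw [← sub_eq_add_neg, abs_neg, abs_of_pos hu] at hyb
  set X := ⟪γ (s + u) - γ s, T s⟫
  set X' := ⟪γ (s - u) - γ s, T s⟫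
  set Y := ⟪γ (s + u) - γ s, ν s⟫
  set Y' := ⟪γ (s - u) - γ s, ν s⟫
  rw [div_lt_div_iff₀ (by linarith) (by linarith)]
  have a1 : X + X' ≤ k / 48 * u ^ 3 := (abs_le.1 h1).2
  have a2 : k / 6 * u ^ 3 ≤ Y' - Y := by
    have := (abs_le.1 h2).2
    linarith
  have a3 : u / 2 ≤ -X' := by
    have := (abs_le.1 h3).2
    linarith
  have a4 : -Y' ≤ u := by linarith [(abs_le.1 hyb).1]
  have b1 : (X + X') * (t - Y') ≤ (k / 48 * u ^ 3) * (2 * u) := by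
    refine (mul_le_mul_of_nonneg_right a1 (by linarith)).trans ?_
    exact mul_le_mul_of_nonneg_left (by linarith) (by positivity)
  have b2 : (u / 2) * (k / 6 * u ^ 3) ≤ -X' * (Y' - Y) :=
    mul_le_mul a3 a2 (by positivity) (by linarith)
  have b3 : 0 < k * u ^ 4 := by positivity
  nlinarith

/-- The point of largest slope lies on the boundary. -/
lemma exists_curve_slope_eq (F : BoundaryFrame S L γ T ν κ) (s : ℝ) {t : ℝ} (ht : 0 < t) :
    ∃ u ∈ Icc (-(L / 2)) (L / 2), ⟪γ (s + u) - γ s, T s⟫ / (t - ⟪γ (s + u) - γ s, ν s⟫) =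
      upperSlope S (γ s) (T s) (ν s) t := by
  have C := F.contactFrame s
  obtain ⟨y, hy, hyq⟩ := C.exists_slope_eq F.compact ht
  set q := upperSlope S (γ s) (T s) (ν s) t with hq
  -- This vector is normal to the tangent ray of slope `q`, so the maximizer has a supporting line
  -- and cannot be interior.
  have hm : (1 : ℝ) • T s + q • ν s ≠ 0 := by
    intro h0
    have := C.norm_sq_frame 1 q
    rw [h0, norm_zero] at this
    nlinarith [sq_nonneg q]
  have hfr : y ∈ frontier S := by
    refine mem_frontier_of_support hy hm fun y' hy' => ?_
    have h1 := C.inner_sub_eq ht hy' 1 q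
    have h2 := C.inner_sub_eq ht hy 1 q
    rw [hyq, one_mul, sub_self, mul_zero] at h2
    have h3 : ⟪y' - y, (1 : ℝ) • T s + q • ν s⟫ =
        (t - ⟪y' - γ s, ν s⟫) * (1 * (⟪y' - γ s, T s⟫ / (t - ⟪y' - γ s, ν s⟫)) - q) := by
      rw [← h1, ← sub_sub_sub_cancel_right y' y (γ s + t • ν s), inner_sub_left, h2, sub_zero]
    rw [h3, one_mul]
    exact mul_nonpos_of_nonneg_of_nonpos (C.depth_pos ht hy').le
      (sub_nonpos.2 (C.slope_le F.compact ht hy'))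
  obtain ⟨v, hv, rfl⟩ := F.exists_mem_Ico hfr (s - L / 2)
  exact ⟨v - s, ⟨by linarith [hv.1], by linarith [hv.2]⟩, by rw [add_sub_cancel]; exact hyq⟩

open Filter Topology in
/-- Close to a boundary point of positive curvature, the largest slope is attained nearby, on the
forward side. -/
theorem exists_slope_eq_near (F : BoundaryFrame S L γ T ν κ) {s : ℝ} (hκ : κ s ≠ 0) {η : ℝ}
    (hη : 0 < η) : ∃ δ > 0, ∀ t, 0 < t → t < δ → ∃ u, 0 < u ∧ u < η ∧ t ≤ u ∧
      ⟪γ (s + u) - γ s, T s⟫ / (t - ⟪γ (s + u) - γ s, ν s⟫) =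
        upperSlope S (γ s) (T s) (ν s) t := by
  have C := F.contactFrame s
  have hL := F.L_pos
  obtain ⟨r, hr, hball⟩ := Metric.eventually_nhds_iff.1
    ((F.eventually_abs_inner_tangent_sub_le s).and (F.eventually_depth_le s))
  simp only [Real.dist_eq, sub_zero] at hball
  set η' := min (min η r) (L / 2) with hη'
  have hη'0 : 0 < η' := lt_min (lt_min hη hr) (by linarith)
  have hη'η : η' ≤ η := (min_le_left _ _).trans (min_le_left _ _)
  have hη'r : η' ≤ r := (min_le_left _ _).trans (min_le_right _ _)
  have hη'L : η' ≤ L / 2 := min_le_right _ _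
  -- away from `s` the boundary has a definite depth
  set K : Set ℝ := Icc (-(L / 2)) (-η') ∪ Icc η' (L / 2) with hK
  have hKc : IsCompact K := isCompact_Icc.union isCompact_Icc
  have hKpos : ∀ u ∈ K, 0 < -⟪γ (s + u) - γ s, ν s⟫ := by
    rintro u (hu | hu)
    · have := F.inner_neg_of_curv_ne_zero hκ (b := s + u + L) (by linarith [hu.1])
        (by linarith [hu.2])
      rw [F.periodic] at this
      linarith
    · have := F.inner_neg_of_curv_ne_zero hκ (b := s + u) (by linarith [hu.1])
        (by linarith [hu.2])
      linarith
  have hcont : Continuous fun u => -⟪γ (s + u) - γ s, ν s⟫ := by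
    have := F.continuous_curve
    fun_prop
  obtain ⟨u₀, hu₀, hmin⟩ := hKc.exists_isMinOn ⟨η', Or.inr ⟨le_rfl, hη'L⟩⟩ hcont.continuousOn
  set m := -⟪γ (s + u₀) - γ s, ν s⟫ with hm
  have hm0 : 0 < m := hKpos u₀ hu₀
  -- At arc length `w = √t` the tangential coordinate is at least `w / 2` and the depth at most `(1
  -- + (κ s / 2 + 1)) * w ^ 2`, so the slope there is at least `c / w`.
  set c := 1 / (2 * (1 + (κ s / 2 + 1))) with hc
  have hκ0 := F.curv_nonneg s
  have hc0 : 0 < c := by positivity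
  set Q := L / 2 / m with hQ
  have hQ0 : 0 < Q := by positivity
  -- The three bounds serve in turn to apply the local estimates at `w`, to conclude `t ≤ u`, and to
  -- exceed `Q`, which bounds all slopes at arc lengths in `K`.
  set w₀ := min η' (min c (c / (Q + 1))) with hw₀
  have hw₀0 : 0 < w₀ := by positivity
  refine ⟨w₀ ^ 2, by positivity, fun t ht htδ => ?_⟩
  set w := Real.sqrt t with hw
  have hw0 : 0 < w := Real.sqrt_pos.2 ht
  have hwt : w ^ 2 = t := Real.sq_sqrt ht.le
  have hww₀ : w < w₀ := by
    rw [hw]; exact (Real.sqrt_lt' hw₀0).2 htδ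
  have hwη : w < η' := hww₀.trans_le (min_le_left _ _)
  have hwc : w < c := hww₀.trans_le ((min_le_right _ _).trans (min_le_left _ _))
  have hwQ : w < c / (Q + 1) := hww₀.trans_le ((min_le_right _ _).trans (min_le_right _ _))
  obtain ⟨u, hu, huq⟩ := F.exists_curve_slope_eq s ht
  set R := upperSlope S (γ s) (T s) (ν s) t with hR
  -- lower bound for the largest slope
  have hRc : c / w ≤ R := by
    refine le_trans ?_ (C.slope_le F.compact ht (F.curve_mem (s + w)))
    obtain ⟨h1, h2⟩ := hball (y := w) (by rw [abs_of_pos hw0]; linarith)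
    rw [abs_of_pos hw0] at h1
    have h3 := (abs_le.1 h1).1
    have h4 := C.depth_pos ht (F.curve_mem (s + w))
    rw [div_le_div_iff₀ hw0 h4]
    have h5 : t - ⟪γ (s + w) - γ s, ν s⟫ ≤ (1 + (κ s / 2 + 1)) * w ^ 2 := by linarith
    calc c * (t - ⟪γ (s + w) - γ s, ν s⟫) ≤ c * ((1 + (κ s / 2 + 1)) * w ^ 2) := by gcongr
      _ = w / 2 * w := by rw [hc]; field_simp
      _ ≤ _ := by gcongr; linarith
  have hd := C.depth_pos ht (F.curve_mem (s + u))
  have hRpos : 0 < R := (by positivity : 0 < c / w).trans_le hRc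
  have hxR : ⟪γ (s + u) - γ s, T s⟫ = R * (t - ⟪γ (s + u) - γ s, ν s⟫) := (div_eq_iff hd.ne').1 huq
  have hx0 : 0 < ⟪γ (s + u) - γ s, T s⟫ := hxR ▸ mul_pos hRpos hd
  have hxu := (le_abs_self _).trans (F.abs_inner_curve_le s u (F.norm_tangent s))
  have hsup := F.support s _ (F.curve_mem (s + u))
  have huη : |u| < η' := by
    by_contra! hcon
    have huK : u ∈ K := by
      rcases le_abs'.1 hcon with h | h
      · exact Or.inl ⟨hu.1, h⟩
      · exact Or.inr ⟨h, hu.2⟩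
    have h1 : m ≤ -⟪γ (s + u) - γ s, ν s⟫ := hmin huK
    have h2 : |u| ≤ L / 2 := abs_le.2 hu
    have h3 : R ≤ Q := by
      rw [← huq, hQ]
      exact div_le_div₀ (by linarith) (by linarith) hm0 (by linarith)
    have h4 : Q + 1 < c / w := by
      rw [lt_div_iff₀ (by linarith)] at hwQ
      rw [lt_div_iff₀ hw0]; linarith
    linarith
  have hupos : 0 < u := by
    by_contra! hcon
    have h1 := (hball (y := u) (by linarith)).1
    rw [abs_of_nonpos hcon] at h1
    linarith [(abs_le.1 h1).2]
  rw [abs_of_pos hupos] at huη hxu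
  refine ⟨u, hupos, huη.trans_le hη'η, ?_, huq⟩
  -- The tangential coordinate is at most `u` and the depth at least `t`. Then `u ≥ R * t ≥ c * w ≥
  -- w ^ 2 = t`.
  have h1 : R * t ≤ u := by
    refine le_trans ?_ hxu
    rw [hxR]
    exact mul_le_mul_of_nonneg_left (by linarith) hRpos.le
  have h2 : c * w ≤ R * t := by
    rw [div_le_iff₀ hw0] at hRc
    calc c * w ≤ R * w * w := by gcongr
      _ = R * t := by rw [← hwt]; ring
  nlinarith

/-- Where the curvature is positive and increasing, the forward slope is smaller than the backward
slope for all points close to the boundary. -/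
theorem upperSlope_lt (F : BoundaryFrame S L γ T ν κ) {s : ℝ} (hκ : κ s ≠ 0)
    (hκ' : 0 < deriv κ s) : ∃ δ > 0, ∀ t, 0 < t → t < δ →
      upperSlope S (γ s) (T s) (ν s) t < upperSlope S (γ s) (-T s) (ν s) t := by
  obtain ⟨η, hη, hlt⟩ := Metric.eventually_nhds_iff.1 (F.eventually_slope_lt hκ')
  obtain ⟨δ, hδ, h⟩ := F.exists_slope_eq_near hκ hη
  refine ⟨δ, hδ, fun t ht htδ => ?_⟩
  obtain ⟨u, hu, huη, htu, huq⟩ := h t ht htδ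
  rw [← huq]
  refine (hlt (y := u) (by rwa [Real.dist_eq, sub_zero, abs_of_pos hu]) hu t ht htu).trans_le ?_
  exact (F.contactFrame s).neg.slope_le F.compact ht (F.curve_mem _)

theorem upperSlope_gt (F : BoundaryFrame S L γ T ν κ) {s : ℝ} (hκ : κ s ≠ 0)
    (hκ' : deriv κ s < 0) : ∃ δ > 0, ∀ t, 0 < t → t < δ →
      upperSlope S (γ s) (-T s) (ν s) t < upperSlope S (γ s) (T s) (ν s) t := by
  have := F.reverse.upperSlope_lt (s := -s) (by simpa using hκ)
    (by rw [deriv_comp_neg, neg_neg]; linarith)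
  simpa using this

/-- The forward maximum is attained on the circular arc, and reflection in the normal at `γ s` gives
a backward point of the same slope. The opposite inequality follows by reversal. -/
lemma upperSlope_le_of_const_curv (F : BoundaryFrame S L γ T ν κ) {s η k : ℝ} (hk : k ≠ 0)
    (hη : 0 < η) (hκ : ∀ u ∈ Ioo (s - η) (s + η), κ u = k) : ∃ δ > 0, ∀ t, 0 < t → t < δ →
      upperSlope S (γ s) (T s) (ν s) t ≤ upperSlope S (γ s) (-T s) (ν s) t := by
  obtain ⟨δ, hδ, h⟩ := F.exists_slope_eq_near
    (by rw [hκ s ⟨by linarith, by linarith⟩]; exact hk) hη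
  refine ⟨δ, hδ, fun t ht htδ => ?_⟩
  obtain ⟨u, hu, huη, -, huq⟩ := h t ht htδ
  have C := F.contactFrame s
  have h1 := C.neg.slope_le F.compact ht (F.curve_mem (s + -u))
  rw [← huq]
  refine le_trans (le_of_eq ?_) h1
  rw [F.curve_of_const_curv hk hκ (u := u) (by rwa [abs_of_pos hu]),
    F.curve_of_const_curv hk hκ (u := -u) (by rwa [abs_neg, abs_of_pos hu])]
  simp only [inner_add_left, inner_smul_left, inner_neg_right, C.orth, real_inner_comm (T s) (ν s),
    real_inner_self_eq_norm_sq, C.norm_e, C.norm_n, conj_trivial, mul_neg, Real.sin_neg,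
    Real.cos_neg]
  ring

/-- On a circular arc the two slopes agree for all points close to the boundary. -/
theorem upperSlope_eq_of_const_curv (F : BoundaryFrame S L γ T ν κ) {s η k : ℝ} (hk : k ≠ 0)
    (hη : 0 < η) (hκ : ∀ u ∈ Ioo (s - η) (s + η), κ u = k) : ∃ δ > 0, ∀ t, 0 < t → t < δ →
      upperSlope S (γ s) (T s) (ν s) t = upperSlope S (γ s) (-T s) (ν s) t := by
  obtain ⟨δ₁, hδ₁, h₁⟩ := F.upperSlope_le_of_const_curv hk hη hκ
  obtain ⟨δ₂, hδ₂, h₂⟩ := F.reverse.upperSlope_le_of_const_curv (s := -s) hk hη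
    (fun u hu => hκ (-u) ⟨by linarith [hu.2], by linarith [hu.1]⟩)
  refine ⟨min δ₁ δ₂, lt_min hδ₁ hδ₂, fun t ht htδ => le_antisymm
    (h₁ t ht (htδ.trans_le (min_le_left _ _))) ?_⟩
  have := h₂ t ht (htδ.trans_le (min_le_right _ _))
  simpa using this

/-- The slopes depend continuously on the point outside `S`. -/
lemma continuousOn_upperSlope (F : BoundaryFrame S L γ T ν κ) {e : ℝ → Plane} (he : Continuous e) :
    ContinuousOn (fun z : ℝ × ℝ => upperSlope S (γ z.1) (e z.1) (ν z.1) z.2) (univ ×ˢ Ioi 0) := by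
  have h1 := F.continuous_curve
  have h2 := F.continuous_normal
  -- Truncating the denominator makes the quotient jointly continuous for every `y`, as the supremum
  -- theorem requires. With `c = t / 2` the truncation has no effect on `S` near `(s, t)`.
  have key : ∀ c : ℝ, 0 < c → Continuous fun z : ℝ × ℝ =>
      sSup ((fun y => ⟪y - γ z.1, e z.1⟫ / max c (z.2 - ⟪y - γ z.1, ν z.1⟫)) '' S) := by
    intro c hc
    refine F.compact.continuous_sSup (f := fun (z : ℝ × ℝ) y =>
      ⟪y - γ z.1, e z.1⟫ / max c (z.2 - ⟪y - γ z.1, ν z.1⟫)) ?_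
    refine Continuous.div (by fun_prop) (by fun_prop) fun x => (lt_max_of_lt_left hc).ne'
  rintro ⟨s, t⟩ ⟨-, ht⟩
  have ht' : 0 < t := ht
  refine ContinuousAt.continuousWithinAt ?_
  refine ((key (t / 2) (by linarith)).continuousAt (x := (s, t))).congr ?_
  have hev : ∀ᶠ z : ℝ × ℝ in nhds (s, t), t / 2 < z.2 :=
    continuous_snd.continuousAt.eventually (lt_mem_nhds (by simp only; linarith))
  filter_upwards [hev] with z hz
  rw [upperSlope]
  congr 1
  refine image_congr fun y hy => ?_
  rw [max_eq_right]
  linarith [F.support z.1 y hy]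

end BoundaryFrame

/-! ### The four vertex theorem for convex curves -/

lemma exists_isLocalMax_Ioo {f : ℝ → ℝ} (hf : Continuous f) {a b c : ℝ} (hc : c ∈ Icc a b)
    (ha : f a < f c) (hb : f b < f c) : ∃ y ∈ Ioo a b, IsLocalMax f y ∧ f c ≤ f y := by
  obtain ⟨y, hy, hmax⟩ := isCompact_Icc.exists_isMaxOn ⟨c, hc⟩ hf.continuousOn
  have hcy : f c ≤ f y := hmax hc
  have hya : a < y := lt_of_le_of_ne hy.1 fun h => by rw [h] at ha; linarith
  have hyb : y < b := lt_of_le_of_ne hy.2 fun h => by rw [← h] at hb; linarith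
  exact ⟨y, ⟨hya, hyb⟩, hmax.isLocalMax (Icc_mem_nhds hya hyb), hcy⟩

lemma exists_isLocalMin_Ioo {f : ℝ → ℝ} (hf : Continuous f) {a b c : ℝ} (hc : c ∈ Icc a b)
    (ha : f c < f a) (hb : f c < f b) : ∃ y ∈ Ioo a b, IsLocalMin f y ∧ f y ≤ f c := by
  obtain ⟨y, hy, hmax, hle⟩ := exists_isLocalMax_Ioo hf.neg hc (by simpa using ha)
    (by simpa using hb)
  exact ⟨y, hy, by simpa using hmax.neg, by simpa using hle⟩

lemma deriv_nonneg_of_monotoneOn_Icc {f : ℝ → ℝ} {a b u : ℝ} (h : MonotoneOn f (Icc a b))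
    (hu : u ∈ Ioo a b) : 0 ≤ deriv f u := by
  rw [← derivWithin_of_mem_nhds (Icc_mem_nhds hu.1 hu.2)]
  exact h.derivWithin_nonneg

namespace BoundaryFrame

variable {S : Set Plane} {L : ℝ} {γ T ν : ℝ → Plane} {κ : ℝ → ℝ}

lemma inner_neg_of_curve_ne (F : BoundaryFrame S L γ T ν κ) {a b : ℝ} (hκ : κ a ≠ 0)
    (h : γ b ≠ γ a) : ⟪γ b - γ a, ν a⟫ < 0 := by
  obtain ⟨u, hu, hub⟩ := F.exists_mem_Ico (F.curve_mem_frontier b) a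
  rw [← hub] at h ⊢
  exact F.inner_neg_of_curv_ne_zero hκ (lt_of_le_of_ne hu.1 fun h0 => h (by rw [h0])) hu.2

/-- If the supporting line at `γ b` contains `γ a`, then the outward normals agree. -/
lemma normal_eq_of_inner_eq_zero (F : BoundaryFrame S L γ T ν κ) {a b : ℝ}
    (h : ⟪γ a - γ b, ν b⟫ = 0) : ν b = ν a := by
  refine F.eq_normal ⟨F.norm_normal b, fun y hy => ?_⟩
  rw [← sub_sub_sub_cancel_right y (γ a) (γ b), inner_sub_left, h, sub_zero]
  exact F.support b y hy

/-- Two nonpositive numbers with a vanishing positive combination are both zero. -/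
lemma inner_eq_zero_of_sbtw (F : BoundaryFrame S L γ T ν κ) {a b c : ℝ}
    (h : Sbtw ℝ (γ a) (γ b) (γ c)) : ⟪γ a - γ b, ν b⟫ = 0 ∧ ⟪γ c - γ b, ν b⟫ = 0 := by
  obtain ⟨θ, hθ, hb⟩ := (sbtw_iff_mem_image_Ioo_and_ne.1 h).1
  have h1 := F.support b _ (F.curve_mem a)
  have h2 := F.support b _ (F.curve_mem c)
  have h3 : (1 - θ) • (γ a - γ b) + θ • (γ c - γ b) = 0 := by
    rw [AffineMap.lineMap_apply_module] at hb
    rw [← hb]; module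
  have h4 := congrArg (fun v => ⟪v, ν b⟫) h3
  simp only [inner_add_left, inner_smul_left, inner_zero_left, conj_trivial] at h4
  constructor <;> nlinarith [hθ.1, hθ.2]

/-- The supporting line at the middle one of three collinear boundary points contains the other two.
If the middle point is not `γ b`, its normal equals the one at `b`, so in every case the supporting
line at `b` touches twice, which `κ b ≠ 0` forbids. -/
lemma not_collinear (F : BoundaryFrame S L γ T ν κ) {a b c : ℝ} (hκ : κ b ≠ 0)
    (hab : γ a ≠ γ b) (hbc : γ b ≠ γ c) (hac : γ a ≠ γ c) :
    ¬ Collinear ℝ {γ a, γ b, γ c} := by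
  intro hcol
  have key : ∀ w, γ w ≠ γ b → ⟪γ b - γ w, ν w⟫ = 0 → False := by
    intro w hw h
    have hn := F.normal_eq_of_inner_eq_zero h
    have := F.inner_neg_of_curve_ne hκ hw
    rw [← hn, ← neg_sub, inner_neg_left, h] at this
    simp at this
  rcases hcol.wbtw_or_wbtw_or_wbtw with h | h | h
  · have := F.inner_neg_of_curve_ne hκ hab
    rw [(F.inner_eq_zero_of_sbtw ⟨h, hab.symm, hbc⟩).1] at this
    exact lt_irrefl _ this
  · exact key c hbc.symm (F.inner_eq_zero_of_sbtw ⟨h, hbc.symm, hac.symm⟩).1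
  · exact key a hab (F.inner_eq_zero_of_sbtw ⟨h, hac, hab⟩).2

/-- The curvature has more than one maximum and one minimum. -/
theorem not_monotone_antitone (F : BoundaryFrame S L γ T ν κ) {p q : ℝ} (hpq : p < q)
    (hqp : q < p + L) (hκ : κ p < κ q) (hmono : MonotoneOn κ (Icc p q))
    (hanti : AntitoneOn κ (Icc q (p + L))) : False := by
  have hκq : κ q ≠ 0 := ((F.curv_nonneg p).trans_lt hκ).ne'
  have hpqne : γ p ≠ γ q := F.curve_ne p q hpq hqp
  -- a unit normal `m` of the line through `γ p` and `γ q`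
  obtain ⟨m, hm, hdm, hTm⟩ : ∃ m : Plane, ‖m‖ = 1 ∧ ⟪γ q - γ p, m⟫ = 0 ∧ 0 < ⟪T q, m⟫ := by
    have hd : 0 < ‖γ q - γ p‖ := norm_pos_iff.2 (sub_ne_zero.2 hpqne.symm)
    set m := ‖γ q - γ p‖⁻¹ • quarterTurn (γ q - γ p) with hmdef
    have hm : ‖m‖ = 1 := by
      rw [hmdef, norm_smul, norm_inv, norm_norm, norm_quarterTurn, inv_mul_cancel₀ hd.ne']
    have hdm : ⟪γ q - γ p, m⟫ = 0 := by
      rw [hmdef, inner_smul_right, inner_quarterTurn_self, mul_zero]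
    have hT0 : ⟪T q, m⟫ ≠ 0 := by
      intro h0
      have hexp := plane_expand (F.norm_tangent q) (F.norm_normal q) (F.orth q) m
      rw [real_inner_comm, h0, zero_smul, zero_add] at hexp
      have h1 := F.inner_neg_of_curve_ne hκq hpqne
      rw [hexp, inner_smul_right] at hdm
      rcases mul_eq_zero.1 hdm with h2 | h2
      · rw [h2, zero_smul] at hexp
        rw [hexp, norm_zero] at hm
        exact zero_ne_one hm
      · rw [← neg_sub, inner_neg_left, h2, neg_zero] at h1
        exact lt_irrefl _ h1
    rcases lt_or_gt_of_ne hT0 with h | h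
    · exact ⟨-m, by rwa [norm_neg], by rw [inner_neg_right, hdm, neg_zero],
        by rw [inner_neg_right]; linarith⟩
    · exact ⟨m, hm, hdm, h⟩
  set f : ℝ → ℝ := fun u => ⟪γ u - γ p, m⟫ with hf
  have hfd : ∀ u, HasDerivAt f ⟪T u, m⟫ u := F.hasDerivAt_inner_curve _ _
  have hfc : Continuous f := continuous_iff_continuousAt.2 fun u => (hfd u).continuousAt
  have hfq : f q = 0 := hdm
  -- The chord line meets the boundary only at its two end points, so `f` has a constant sign on
  -- each open arc. The first order expansion at `q`, where the line is crossed transversally,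
  -- determines both signs.
  have hf0 : ∀ u, γ u ≠ γ p → γ u ≠ γ q → f u ≠ 0 := by
    intro u hup huq hfu
    refine F.not_collinear hκq hpqne huq.symm hup.symm
      ((collinear_iff_of_mem (p₀ := γ p) (by simp)).2 ⟨quarterTurn m, ?_⟩)
    have hexp : ∀ x : Plane, ⟪x, m⟫ = 0 → x = ⟪x, quarterTurn m⟫ • quarterTurn m := by
      intro x hx
      have := plane_expand (e := quarterTurn m) (by rw [norm_quarterTurn, hm]) hm
        (by rw [real_inner_comm]; exact inner_quarterTurn_self m) x
      rwa [hx, zero_smul, add_zero] at this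
    rintro x (rfl | rfl | rfl)
    · exact ⟨0, by simp⟩
    · exact ⟨_, by rw [vadd_eq_add]; exact eq_add_of_sub_eq (hexp _ hdm)⟩
    · exact ⟨_, by rw [vadd_eq_add]; exact eq_add_of_sub_eq (hexp _ hfu)⟩
  have hperp : γ (p + L) = γ p := F.periodic p
  have hleft : ∀ u ∈ Ioo p q, f u ≠ 0 := fun u hu =>
    hf0 u (F.curve_ne p u hu.1 (by linarith [hu.2])).symm (F.curve_ne u q hu.2 (by linarith [hu.1]))
  have hright : ∀ u ∈ Ioo q (p + L), f u ≠ 0 := fun u hu =>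
    hf0 u (hperp ▸ F.curve_ne u (p + L) hu.2 (by linarith [hu.1]))
      (F.curve_ne q u hu.1 (by linarith [hu.2])).symm
  have hsl : ∀ᶠ u in nhds q, |f u - (u - q) * ⟪T q, m⟫| ≤ ⟪T q, m⟫ / 2 * |u - q| := by
    have := Asymptotics.isLittleO_iff.1 (hasDerivAt_iff_isLittleO.1 (hfd q))
      (c := ⟪T q, m⟫ / 2) (by linarith)
    simpa [hfq] using this
  obtain ⟨r, hr, hball⟩ := Metric.eventually_nhds_iff.1 hsl
  have hfleft : ∀ u ∈ Ioo p q, f u < 0 := by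
    set v := max (q - r / 2) ((p + q) / 2) with hv
    have hvI : v ∈ Ioo p q := ⟨lt_max_of_lt_right (by linarith), max_lt (by linarith) (by linarith)⟩
    have hvr : q - r / 2 ≤ v := le_max_left _ _
    have hfv : f v < 0 := by
      have := hball (y := v) (by rw [Real.dist_eq, abs_of_neg (by linarith [hvI.2])]; linarith)
      rw [abs_of_neg (show v - q < 0 by linarith [hvI.2])] at this
      nlinarith [(abs_le.1 this).2, mul_pos hTm (show 0 < q - v by linarith [hvI.2])]
    intro u hu
    by_contra! hcon
    obtain ⟨w, hw, hw0⟩ := isPreconnected_Ioo.intermediate_value hvI hu hfc.continuousOn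
      (show (0 : ℝ) ∈ Icc (f v) (f u) from ⟨hfv.le, hcon⟩)
    exact hleft w hw hw0
  have hfright : ∀ u ∈ Ioo q (p + L), 0 < f u := by
    set v := min (q + r / 2) ((q + (p + L)) / 2) with hv
    have hvI : v ∈ Ioo q (p + L) :=
      ⟨lt_min (by linarith) (by linarith), min_lt_of_right_lt (by linarith)⟩
    have hvr : v ≤ q + r / 2 := min_le_left _ _
    have hfv : 0 < f v := by
      have := hball (y := v) (by rw [Real.dist_eq, abs_of_pos (by linarith [hvI.1])]; linarith)
      rw [abs_of_pos (show 0 < v - q by linarith [hvI.1])] at this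
      nlinarith [(abs_le.1 this).1, mul_pos hTm (show 0 < v - q by linarith [hvI.1])]
    intro u hu
    by_contra! hcon
    obtain ⟨w, hw, hw0⟩ := isPreconnected_Ioo.intermediate_value hu hvI hfc.continuousOn
      (show (0 : ℝ) ∈ Icc (f u) (f v) from ⟨hcon, hfv.le⟩)
    exact hright w hw hw0
  have hκd : ∀ u, HasDerivAt κ (deriv κ u) u := fun u =>
    (F.contDiff_curv.differentiable (by norm_num) u).hasDerivAt
  -- an antiderivative of `κ' f`
  set Φ : ℝ → ℝ := fun u => κ u * f u - ⟪ν u, m⟫ with hΦ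
  have hΦd : ∀ u, HasDerivAt Φ (deriv κ u * f u) u := by
    intro u
    refine (((hκd u).mul (hfd u)).sub (F.hasDerivAt_inner_normal m u)).congr_deriv ?_
    ring
  have hΦc : Continuous Φ := continuous_iff_continuousAt.2 fun u => (hΦd u).continuousAt
  have hΦper : Φ (p + L) = Φ p := by
    simp only [hΦ, hf, F.periodic p, F.periodic_normal p, F.periodic_curv p]
  have hA1 : AntitoneOn Φ (Icc p q) := by
    refine antitoneOn_of_deriv_nonpos (convex_Icc _ _) hΦc.continuousOn
      (fun u _ => (hΦd u).differentiableAt.differentiableWithinAt) fun u hu => ?_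
    rw [interior_Icc] at hu
    rw [(hΦd u).deriv]
    exact mul_nonpos_of_nonneg_of_nonpos (deriv_nonneg_of_monotoneOn_Icc hmono hu) (hfleft u hu).le
  have hA2 : AntitoneOn Φ (Icc q (p + L)) := by
    refine antitoneOn_of_deriv_nonpos (convex_Icc _ _) hΦc.continuousOn
      (fun u _ => (hΦd u).differentiableAt.differentiableWithinAt) fun u hu => ?_
    rw [interior_Icc] at hu
    rw [(hΦd u).deriv]
    have := deriv_nonneg_of_monotoneOn_Icc hanti.neg hu
    rw [deriv.fun_neg] at this
    exact mul_nonpos_of_nonpos_of_nonneg (by linarith) (hfright u hu).le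
  have h1 := hA2 (left_mem_Icc.2 hqp.le) (right_mem_Icc.2 hqp.le) hqp.le
  -- An antitone function on a full period with equal end values is constant. So `κ' f = 0` on the
  -- first arc, and since `f ≠ 0` there, `κ` could not have increased.
  have hconst : ∀ u ∈ Icc p q, Φ u = Φ p := fun u hu =>
    le_antisymm (hA1 (left_mem_Icc.2 hpq.le) hu hu.1)
      (by linarith [hA1 hu (right_mem_Icc.2 hpq.le) hu.2])
  obtain ⟨u, hu, hslope⟩ := exists_deriv_eq_slope κ hpq F.continuous_curv.continuousOn
    (fun u _ => (hκd u).differentiableAt.differentiableWithinAt)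
  have hΦ0 : deriv κ u * f u = 0 := by
    have h2 : Φ =ᶠ[nhds u] fun _ => Φ p := by
      filter_upwards [Icc_mem_nhds hu.1 hu.2] with v hv using hconst v hv
    exact ((hΦd u).congr_of_eventuallyEq h2.symm).unique (hasDerivAt_const u (Φ p))
  rcases mul_eq_zero.1 hΦ0 with h2 | h2
  · rw [h2, eq_comm, div_eq_zero_iff] at hslope
    rcases hslope with h3 | h3 <;> linarith
  · exact hleft u hu h2

/-! ### Vertices on disjoint flat pieces -/

lemma inner_eq_zero_of_mem_flatPiece (F : BoundaryFrame S L γ T ν κ) {a b : ℝ}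
    (h : γ b ∈ flatPiece S (γ a)) : ⟪γ b - γ a, ν a⟫ = 0 := by
  obtain ⟨w, hw⟩ : midpoint ℝ (γ a) (γ b) ∈ range γ := by
    rw [F.range_eq]; exact h (midpoint_mem_segment _ _)
  by_cases hab : γ a = γ b
  · rw [hab, sub_self, inner_zero_left]
  have hs : Sbtw ℝ (γ a) (γ w) (γ b) := by rw [hw]; exact sbtw_midpoint_of_ne ℝ hab
  obtain ⟨h1, h2⟩ := F.inner_eq_zero_of_sbtw hs
  rw [← F.normal_eq_of_inner_eq_zero h1, ← sub_sub_sub_cancel_right (γ b) (γ a) (γ w),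
    inner_sub_left, h1, h2, sub_zero]

lemma flatPiece_subset_frontier (x : Plane) : flatPiece S x ⊆ frontier S := fun y hy =>
  hy (right_mem_segment ℝ x y)

/-- A common point would have the same normal as both `γ a` and `γ b`. Then the supporting line at
`γ a` contains `γ b`, and one of the two arcs is flat. -/
lemma disjoint_flatPiece (F : BoundaryFrame S L γ T ν κ) {a b : ℝ} (hab : a < b) (hba : b < a + L)
    (h1 : ∃ u ∈ Icc a b, κ u ≠ 0) (h2 : ∃ u ∈ Icc b (a + L), κ u ≠ 0) :
    Disjoint (flatPiece S (γ a)) (flatPiece S (γ b)) := by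
  rw [Set.disjoint_left]
  intro z hza hzb
  obtain ⟨c, rfl⟩ : z ∈ range γ := F.range_eq ▸ flatPiece_subset_frontier _ hza
  have ha := F.inner_eq_zero_of_mem_flatPiece hza
  have hb := F.inner_eq_zero_of_mem_flatPiece hzb
  have hν : ν b = ν a :=
    (F.normal_eq_of_inner_eq_zero hb).trans (F.normal_eq_of_inner_eq_zero ha).symm
  rw [hν] at hb
  have : ⟪γ b - γ a, ν a⟫ = 0 := by
    rw [← sub_sub_sub_cancel_left (γ a) (γ b) (γ c), inner_sub_left, ha, hb, sub_zero]
  rcases F.flat_of_common_support hab hba this with h | h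
  · obtain ⟨u, hu, hκ⟩ := h1; exact hκ (h u hu)
  · obtain ⟨u, hu, hκ⟩ := h2; exact hκ (h u hu)

/-- For any two of the four parameters, each of the two closed arcs between them contains `b` or `d`
modulo the period. -/
lemma four_extrema_of_alternating (F : BoundaryFrame S L γ T ν κ) {a b c d : ℝ} (hab : a < b)
    (hbc : b < c) (hcd : c < d) (hda : d < a + L) (hb : κ b ≠ 0) (hd : κ d ≠ 0)
    (ha' : IsLocalExtr κ a) (hb' : IsLocalExtr κ b) (hc' : IsLocalExtr κ c)
    (hd' : IsLocalExtr κ d) : ∃ s : Fin 4 → ℝ, (∀ i, IsLocalExtr κ (s i)) ∧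
      ∀ i j, i ≠ j → Disjoint (flatPiece S (γ (s i))) (flatPiece S (γ (s j))) := by
  refine ⟨![a, b, c, d], fun i => by fin_cases i <;> assumption, ?_⟩
  have hlt : ∀ i j : Fin 4, i < j →
      Disjoint (flatPiece S (γ (![a, b, c, d] i))) (flatPiece S (γ (![a, b, c, d] j))) := by
    intro i j hij
    fin_cases i <;> fin_cases j <;> simp at hij <;> simp only [Fin.reduceFinMk, Fin.zero_eta,
      Fin.mk_one, Matrix.cons_val]
    all_goals
      refine F.disjoint_flatPiece (by linarith) (by linarith) ?_ ⟨d, ⟨by linarith, by linarith⟩, hd⟩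
      first
        | exact ⟨b, ⟨by linarith, by linarith⟩, hb⟩
        | exact ⟨d, ⟨by linarith, by linarith⟩, hd⟩
  intro i j hij
  rcases lt_or_gt_of_ne hij with h | h
  · exact hlt i j h
  · exact (hlt j i h).symm

/-- The four vertex theorem, with vertices on pairwise disjoint flat pieces. -/
theorem exists_four_extrema (F : BoundaryFrame S L γ T ν κ) :
    ∃ s : Fin 4 → ℝ, (∀ i, IsLocalExtr κ (s i)) ∧
      ∀ i j, i ≠ j → Disjoint (flatPiece S (γ (s i))) (flatPiece S (γ (s j))) := by
  have hL := F.L_pos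
  obtain ⟨p, -, hp⟩ := isCompact_Icc.exists_isMinOn (nonempty_Icc.2 hL.le)
    F.continuous_curv.continuousOn
  have hpmin : ∀ u, κ p ≤ κ u := by
    intro u
    obtain ⟨v, hv, hvu⟩ := F.periodic_curv.exists_mem_Ico₀ hL u
    rw [hvu]
    exact hp (Ico_subset_Icc_self hv)
  obtain ⟨q, hq, hq'⟩ := isCompact_Icc.exists_isMaxOn
    (nonempty_Icc.2 (by linarith : p ≤ p + L)) F.continuous_curv.continuousOn
  have hqmax : ∀ u, κ u ≤ κ q := by
    intro u
    obtain ⟨v, hv, hvu⟩ := F.periodic_curv.exists_mem_Ico hL u p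
    rw [hvu]
    exact hq' (Ico_subset_Icc_self hv)
  have hpe : IsLocalExtr κ p := Or.inl (Filter.Eventually.of_forall hpmin)
  have hqe : IsLocalExtr κ q := Or.inr (Filter.Eventually.of_forall hqmax)
  rcases (hpmin q).eq_or_lt with heq | hlt
  · have hconst : ∀ u, κ u = κ p := fun u => le_antisymm (heq ▸ hqmax u) (hpmin u)
    have hne : ∀ u, κ u ≠ 0 := by
      obtain ⟨v, hv⟩ := F.exists_curv_ne_zero
      intro u
      rwa [hconst u, ← hconst v]
    have hext : ∀ u, IsLocalExtr κ u := fun u =>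
      Or.inl (Filter.Eventually.of_forall fun v => by rw [hconst u, hconst v])
    exact F.four_extrema_of_alternating (a := 0) (b := L / 4) (c := L / 2) (d := 3 * L / 4)
      (by linarith) (by linarith) (by linarith) (by linarith) (hne _) (hne _) (hext _) (hext _)
      (hext _) (hext _)
  · have hpq : p < q := lt_of_le_of_ne hq.1 fun h => by rw [h] at hlt; exact lt_irrefl _ hlt
    have hqp : q < p + L := lt_of_le_of_ne hq.2 fun h => by
      rw [h, F.periodic_curv] at hlt; exact lt_irrefl _ hlt
    have hκp := F.curv_nonneg p
    have hκ := F.continuous_curv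
    have hnot := fun h => F.not_monotone_antitone hpq hqp hlt h
    -- Monotonicity fails on one of the two arcs, which yields an extra local minimum and an extra
    -- local maximum inside it. The two maxima have larger values than some point, hence positive
    -- curvature.
    by_cases hmono : MonotoneOn κ (Icc p q)
    · have hanti := hnot hmono
      obtain ⟨u, hu, v, hv, huv, hκuv⟩ : ∃ u ∈ Icc q (p + L), ∃ v ∈ Icc q (p + L), u ≤ v ∧
          κ u < κ v := by
        by_contra! hcon
        exact hanti fun u hu v hv huv => hcon u hu v hv huv
      have hperp := F.periodic_curv p
      obtain ⟨y, hy, hymin, hyu⟩ := exists_isLocalMin_Ioo hκ (a := q) (b := v) (c := u)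
        ⟨hu.1, huv⟩ (hκuv.trans_le (hqmax v)) hκuv
      obtain ⟨z, hz, hzmax, hzv⟩ := exists_isLocalMax_Ioo hκ (a := y) (b := p + L) (c := v)
        ⟨hy.2.le, hv.2⟩ (hyu.trans_lt hκuv) (by
          rw [hperp]; exact (hpmin u).trans_lt hκuv)
      exact F.four_extrema_of_alternating hpq hy.1 hz.1 hz.2 (by linarith)
        (by linarith [hpmin u]) hpe hqe (Or.inl hymin) (Or.inr hzmax)
    · simp only [MonotoneOn] at hmono
      push Not at hmono
      obtain ⟨u, hu, v, hv, huv, hκuv⟩ := hmono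
      obtain ⟨y, hy, hymax, hyu⟩ := exists_isLocalMax_Ioo hκ (a := p) (b := v) (c := u)
        ⟨hu.1, huv⟩ ((hpmin v).trans_lt hκuv) hκuv
      obtain ⟨z, hz, hzmin, hzv⟩ := exists_isLocalMin_Ioo hκ (a := y) (b := q) (c := v)
        ⟨hy.2.le, hv.2⟩ (hκuv.trans_le hyu) (hκuv.trans_le (hqmax u))
      exact F.four_extrema_of_alternating hy.1 hz.1 hz.2 hqp (by linarith [hpmin v])
        (by linarith) hpe (Or.inr hymax) (Or.inl hzmin) hqe

end BoundaryFrame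

/-! ### Local families of fixed points -/

lemma IsLocalFixedFamily.mono {S U V : Set Plane} {C : Set (Plane × Plane)}
    (h : IsLocalFixedFamily S U C) (hUV : U ⊆ V) : IsLocalFixedFamily S V C :=
  ⟨h.1, fun z hz => hUV (h.2.1 z hz), h.2.2⟩

/-- The distances to `S` within the family fill an interval. -/
lemma IsLocalFixedFamily.not_countable {S U : Set Plane} {C : Set (Plane × Plane)}
    (h : IsLocalFixedFamily S U C) : ¬ (exteriorFixedPoints S).Countable := by
  obtain ⟨hC, -, -, δ, hδ, hlev⟩ := h
  intro hcount
  have h1 : (Ioo 0 δ).Countable := by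
    refine ((hcount.mono hC).image fun z => infDist z.1 S).mono fun t ht => ?_
    obtain ⟨z, hz, hzt⟩ := hlev t ht
    exact ⟨z, hz, hzt⟩
  have h2 := h1.measure_zero MeasureTheory.volume
  rw [Real.volume_Ioo, sub_zero, ENNReal.ofReal_eq_zero] at h2
  linarith

/-- Compactness is what allows disjoint flat pieces to have disjoint thickenings. -/
lemma isCompact_flatPiece {S : Set Plane} (hS : IsCompact S) (x : Plane) :
    IsCompact (flatPiece S x) := by
  have heq : flatPiece S x = ⋂ θ ∈ Icc (0 : ℝ) 1, {y | x + θ • (y - x) ∈ frontier S} := by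
    ext y
    simp only [flatPiece, mem_ofPred_eq, segment_eq_image', image_subset_iff, mem_iInter]
    rfl
  refine hS.of_isClosed_subset ?_ fun y hy =>
    hS.isClosed.frontier_subset (hy (right_mem_segment ℝ x y))
  rw [heq]
  exact isClosed_biInter fun θ _ => isClosed_frontier.preimage (by fun_prop)

namespace BoundaryFrame

variable {S : Set Plane} {L : ℝ} {γ T ν : ℝ → Plane} {κ : ℝ → ℝ}

/-- A connected set of parameters at which the two slopes agree yields a family of fixed points. -/
lemma isLocalFixedFamily_image (F : BoundaryFrame S L γ T ν κ) {U : Set Plane} {C : Set (ℝ × ℝ)}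
    {δ : ℝ} (hδ : 0 < δ) (hC : IsConnected C) (hpos : ∀ z ∈ C, 0 < z.2)
    (heq : ∀ z ∈ C, upperSlope S (γ z.1) (T z.1) (ν z.1) z.2 =
      upperSlope S (γ z.1) (-T z.1) (ν z.1) z.2)
    (hU : ∀ z ∈ C, γ z.1 + z.2 • ν z.1 ∈ U) (hlev : ∀ t ∈ Ioo 0 δ, ∃ z ∈ C, z.2 = t) :
    IsLocalFixedFamily S U ((fun z : ℝ × ℝ => (γ z.1 + z.2 • ν z.1, -ν z.1)) '' C) := by
  have h1 := F.continuous_curve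
  have h2 := F.continuous_normal
  refine ⟨?_, ?_, hC.image _ (by fun_prop), δ, hδ, ?_⟩
  · rintro _ ⟨z, hz, rfl⟩
    exact (F.contactFrame z.1).mem_exteriorFixedPoints F.compact F.int (fun m => F.eq_normal)
      (hpos z hz) (heq z hz)
  · rintro _ ⟨z, hz, rfl⟩
    exact hU z hz
  · intro t ht
    obtain ⟨z, hz, rfl⟩ := hlev t ht
    exact ⟨_, ⟨z, hz, rfl⟩, (F.contactFrame z.1).infDist_eq (hpos z hz)⟩

lemma offset_mem_thickening (F : BoundaryFrame S L γ T ν κ) {A : Set Plane} {c u t ε : ℝ}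
    (hc : γ c ∈ A) (hu : |u - c| < ε / 2) (ht : 0 < t) (htε : t < ε / 2) :
    γ u + t • ν u ∈ thickening ε A := by
  refine mem_thickening_iff.2 ⟨γ c, hc, ?_⟩
  have h1 := F.norm_curve_sub_le c (u - c)
  rw [add_sub_cancel] at h1
  calc dist (γ u + t • ν u) (γ c) = ‖(γ u - γ c) + t • ν u‖ := by
        rw [dist_eq_norm]; congr 1; module
    _ ≤ ‖γ u - γ c‖ + ‖t • ν u‖ := norm_add_le _ _
    _ < ε := by
        rw [norm_smul, F.norm_normal, mul_one, Real.norm_of_nonneg ht.le]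
        linarith

/-- A circular arc close to `A` carries a family of fixed points. -/
lemma exists_family_of_const_curv (F : BoundaryFrame S L γ T ν κ) {A : Set Plane}
    {c s ε η k : ℝ} (hc : γ c ∈ A) (hs : |s - c| < ε / 2) (hε : 0 < ε) (hk : k ≠ 0) (hη : 0 < η)
    (hκ : ∀ u ∈ Ioo (s - η) (s + η), κ u = k) :
    ∃ C, IsLocalFixedFamily S (thickening ε A) C := by
  obtain ⟨δ, hδ, h⟩ := F.upperSlope_eq_of_const_curv hk hη hκ
  have hm : 0 < min δ (ε / 2) := lt_min hδ (by linarith)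
  refine ⟨_, F.isLocalFixedFamily_image (C := {s} ×ˢ Ioo 0 (min δ (ε / 2))) hm
    (isConnected_singleton.prod (isConnected_Ioo hm)) (fun z hz => hz.2.1) ?_ ?_ ?_⟩
  · rintro ⟨u, t⟩ ⟨rfl, ht⟩
    exact h t ht.1 (ht.2.trans_le (min_le_left _ _))
  · rintro ⟨u, t⟩ ⟨rfl, ht⟩
    exact F.offset_mem_thickening hc hs ht.1 (ht.2.trans_le (min_le_right _ _))
  · intro t ht
    exact ⟨(s, t), ⟨rfl, ht⟩, rfl⟩

/-- If the curvature is monotone in opposite directions at two parameters close to an arc in `A`, then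
the arc between them carries a family of fixed points. -/
lemma exists_family_of_deriv_neg_pos (F : BoundaryFrame S L γ T ν κ) {A : Set Plane}
    {α β a b ε : ℝ} (hε : 0 < ε) (hαβ : α ≤ β) (hA : ∀ u ∈ Icc α β, γ u ∈ A)
    (ha : a ∈ Ioo (α - ε / 2) α) (hb : b ∈ Ioo β (β + ε / 2)) (hκa : κ a ≠ 0) (hκb : κ b ≠ 0)
    (hd : deriv κ a * deriv κ b < 0) : ∃ C, IsLocalFixedFamily S (thickening ε A) C := by
  have hab : a ≤ b := by linarith [ha.2, hb.1]
  have hin : ∀ u ∈ Icc a b, ∀ t, 0 < t → t < ε / 2 → γ u + t • ν u ∈ thickening ε A := by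
    intro u hu t ht htε
    rcases lt_or_ge u α with h1 | h1
    · exact F.offset_mem_thickening (hA α ⟨le_rfl, hαβ⟩)
        (abs_lt.2 ⟨by linarith [ha.1, hu.1], by linarith⟩) ht htε
    rcases lt_or_ge β u with h2 | h2
    · exact F.offset_mem_thickening (hA β ⟨hαβ, le_rfl⟩)
        (abs_lt.2 ⟨by linarith, by linarith [hb.2, hu.2]⟩) ht htε
    · exact F.offset_mem_thickening (hA u ⟨h1, h2⟩) (by rw [sub_self, abs_zero]; linarith) ht htε
  have hc1 := F.continuousOn_upperSlope F.continuous_tangent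
  have hc2 := F.continuousOn_upperSlope F.continuous_tangent.neg
  have main : ∃ δ > 0, δ < ε / 2 ∧ ∃ C : Set (ℝ × ℝ), C ⊆ Icc a b ×ˢ Ioc 0 δ ∧
      (∀ z ∈ C, upperSlope S (γ z.1) (T z.1) (ν z.1) z.2 =
        upperSlope S (γ z.1) (-T z.1) (ν z.1) z.2) ∧ IsConnected C ∧
      ∀ t ∈ Ioc 0 δ, ∃ z ∈ C, z.2 = t := by
    have shrink : ∀ {δ₁ δ₂ : ℝ}, 0 < δ₁ → 0 < δ₂ →
        ∃ δ > 0, δ < δ₁ ∧ δ < δ₂ ∧ δ < ε / 2 := fun {δ₁ δ₂} h1 h2 => by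
      obtain ⟨δ, hδ, hlt⟩ := exists_between (lt_min h1 (lt_min h2 (half_pos hε)))
      rw [lt_min_iff, lt_min_iff] at hlt
      exact ⟨δ, hδ, hlt.1, hlt.2.1, hlt.2.2⟩
    -- The sign of `κ'` at `a` decides which difference of slopes is negative on the left edge.
    rcases mul_neg_iff.1 hd with ⟨hpa, hnb⟩ | ⟨hna, hpb⟩
    · obtain ⟨δ₁, hδ₁, h₁⟩ := F.upperSlope_lt hκa hpa
      obtain ⟨δ₂, hδ₂, h₂⟩ := F.upperSlope_gt hκb hnb
      obtain ⟨δ, hδ, hl₁, hl₂, hlε⟩ := shrink hδ₁ hδ₂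
      obtain ⟨C, hC, hz, hconn, hlev⟩ := exists_connected_zeros_crossing hab hδ (hc1.sub hc2)
        (fun t ht => sub_neg.2 (h₁ t ht.1 (ht.2.trans_lt hl₁)))
        (fun t ht => sub_pos.2 (h₂ t ht.1 (ht.2.trans_lt hl₂)))
      exact ⟨δ, hδ, hlε, C, hC, fun z hzC => sub_eq_zero.1 (hz z hzC), hconn, hlev⟩
    · obtain ⟨δ₁, hδ₁, h₁⟩ := F.upperSlope_gt hκa hna
      obtain ⟨δ₂, hδ₂, h₂⟩ := F.upperSlope_lt hκb hpb
      obtain ⟨δ, hδ, hl₁, hl₂, hlε⟩ := shrink hδ₁ hδ₂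
      obtain ⟨C, hC, hz, hconn, hlev⟩ := exists_connected_zeros_crossing hab hδ (hc2.sub hc1)
        (fun t ht => sub_neg.2 (h₁ t ht.1 (ht.2.trans_lt hl₁)))
        (fun t ht => sub_pos.2 (h₂ t ht.1 (ht.2.trans_lt hl₂)))
      exact ⟨δ, hδ, hlε, C, hC, fun z hzC => (sub_eq_zero.1 (hz z hzC)).symm, hconn, hlev⟩
  obtain ⟨δ, hδ, hδε, C, hC, heq, hconn, hlev⟩ := main
  exact ⟨_, F.isLocalFixedFamily_image hδ hconn (fun z hz => (hC hz).2.1) heq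
    (fun z hz => hin z.1 (hC hz).1 z.2 (hC hz).2.1 ((hC hz).2.2.trans_lt hδε))
    (fun t ht => hlev t (Ioo_subset_Ioc_self ht))⟩

/-- The mean value theorem is applied to `κ ^ 2`, because positivity of `2 * κ * κ'` gives `κ ≠ 0`
along with `κ' > 0`. -/
lemma exists_deriv_pos (F : BoundaryFrame S L γ T ν κ) {x y : ℝ} (hxy : x < y) (h : κ x < κ y) :
    ∃ u ∈ Ioo x y, κ u ≠ 0 ∧ 0 < deriv κ u := by
  have hd : ∀ u, HasDerivAt (fun u => κ u ^ 2) (2 * κ u * deriv κ u) u := fun u => by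
    refine ((F.contDiff_curv.differentiable (by norm_num) u).hasDerivAt.pow 2).congr_deriv ?_
    norm_num
  obtain ⟨u, hu, hslope⟩ := exists_hasDerivAt_eq_slope (fun u => κ u ^ 2) _ hxy
    (F.continuous_curv.pow 2).continuousOn fun u _ => hd u
  have hpos : 0 < 2 * κ u * deriv κ u := by
    rw [hslope]
    have := F.curv_nonneg x
    exact div_pos (by nlinarith) (by linarith)
  have h0 := F.curv_nonneg u
  refine ⟨u, hu, fun h => by rw [h] at hpos; simp at hpos, ?_⟩
  exact pos_of_mul_pos_right hpos (by linarith)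

lemma exists_deriv_neg (F : BoundaryFrame S L γ T ν κ) {x y : ℝ} (hxy : x < y) (h : κ y < κ x) :
    ∃ u ∈ Ioo x y, κ u ≠ 0 ∧ deriv κ u < 0 := by
  obtain ⟨u, hu, h0, hd⟩ := F.reverse.exists_deriv_pos (x := -y) (y := -x) (by linarith)
    (by simpa using h)
  rw [deriv_comp_neg] at hd
  exact ⟨-u, ⟨by linarith [hu.2], by linarith [hu.1]⟩, h0, by linarith⟩

/-- The right end of the flat arc starting at a point of zero curvature. -/
lemma exists_right_end (F : BoundaryFrame S L γ T ν κ) {s : ℝ} (hs : κ s = 0) :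
    ∃ β, s ≤ β ∧ (∀ u ∈ Icc s β, κ u = 0) ∧ ∀ η > 0, ∃ b ∈ Ioo β (β + η), κ b ≠ 0 := by
  obtain ⟨v, hv⟩ := F.exists_curv_ne_zero
  obtain ⟨u, hu, huv⟩ := F.periodic_curv.exists_mem_Ico F.L_pos v s
  -- The end is the infimum of `K`. By continuity the curvature still vanishes there, so points of
  -- `K` accumulate strictly to its right.
  set K : Set ℝ := {u | s ≤ u ∧ κ u ≠ 0} with hK
  have hKne : K.Nonempty := ⟨u, hu.1, huv ▸ hv⟩
  have hKb : BddBelow K := ⟨s, fun x hx => hx.1⟩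
  have hsβ : s ≤ sInf K := le_csInf hKne fun x hx => hx.1
  have hlt : ∀ u, s ≤ u → u < sInf K → κ u = 0 := fun u h1 h2 => by
    by_contra h
    exact absurd (csInf_le hKb (show u ∈ K from ⟨h1, h⟩)) (not_le.2 h2)
  have hβ : κ (sInf K) = 0 := by
    rcases hsβ.eq_or_lt with h | h
    · rwa [← h]
    · have hcl : closure (Ioo s (sInf K)) ⊆ {u | κ u = 0} :=
        closure_minimal (fun u hu => hlt u hu.1.le hu.2)
          (isClosed_eq F.continuous_curv continuous_const)
      rw [closure_Ioo h.ne] at hcl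
      exact hcl (right_mem_Icc.2 h.le)
  refine ⟨sInf K, hsβ, fun u hu => ?_, fun η hη => ?_⟩
  · rcases hu.2.eq_or_lt with h | h
    · rwa [h]
    · exact hlt u hu.1 h
  · obtain ⟨b, hb, hbη⟩ := exists_lt_of_csInf_lt hKne (show sInf K < sInf K + η by linarith)
    exact ⟨b, ⟨lt_of_le_of_ne (csInf_le hKb hb) fun h => hb.2 (h ▸ hβ), hbη⟩, hb.2⟩

/-- A family of fixed points near an arc at whose ends the curvature leaves its extremal value `k`. -/
lemma exists_family_of_ends (F : BoundaryFrame S L γ T ν κ) {A : Set Plane} {α β ε k η : ℝ}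
    (hε : 0 < ε) (hη : 0 < η) (hαβ : α ≤ β) (hA : ∀ u ∈ Icc α β, γ u ∈ A)
    (hα : κ α = k) (hβ : κ β = k)
    (hl : ∀ η > 0, ∃ a ∈ Ioo (α - η) α, κ a ≠ k) (hr : ∀ η > 0, ∃ b ∈ Ioo β (β + η), κ b ≠ k)
    (hext : (∀ u ∈ Ioo (α - η) α ∪ Ioo β (β + η), k ≤ κ u) ∨
      ∀ u ∈ Ioo (α - η) α ∪ Ioo β (β + η), κ u ≤ k) :
    ∃ C, IsLocalFixedFamily S (thickening ε A) C := by
  have hm : 0 < min η (ε / 2) := lt_min hη (by linarith)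
  obtain ⟨a₀, ha₀, hka⟩ := hl _ hm
  obtain ⟨b₀, hb₀, hkb⟩ := hr _ hm
  have ha1 : α - η < a₀ := by linarith [ha₀.1, min_le_left η (ε / 2)]
  have ha2 : α - ε / 2 < a₀ := by linarith [ha₀.1, min_le_right η (ε / 2)]
  have hb1 : b₀ < β + η := by linarith [hb₀.2, min_le_left η (ε / 2)]
  have hb2 : b₀ < β + ε / 2 := by linarith [hb₀.2, min_le_right η (ε / 2)]
  rcases hext with h | h
  · obtain ⟨a, ha, ha0, had⟩ := F.exists_deriv_neg ha₀.2
      (hα ▸ lt_of_le_of_ne (h a₀ (Or.inl ⟨ha1, ha₀.2⟩)) hka.symm)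
    obtain ⟨b, hb, hb0, hbd⟩ := F.exists_deriv_pos hb₀.1
      (hβ ▸ lt_of_le_of_ne (h b₀ (Or.inr ⟨hb₀.1, hb1⟩)) hkb.symm)
    exact F.exists_family_of_deriv_neg_pos hε hαβ hA ⟨by linarith [ha.1], ha.2⟩
      ⟨hb.1, by linarith [hb.2]⟩ ha0 hb0 (mul_neg_of_neg_of_pos had hbd)
  · obtain ⟨a, ha, ha0, had⟩ := F.exists_deriv_pos ha₀.2
      (hα ▸ lt_of_le_of_ne (h a₀ (Or.inl ⟨ha1, ha₀.2⟩)) hka)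
    obtain ⟨b, hb, hb0, hbd⟩ := F.exists_deriv_neg hb₀.1
      (hβ ▸ lt_of_le_of_ne (h b₀ (Or.inr ⟨hb₀.1, hb1⟩)) hkb)
    exact F.exists_family_of_deriv_neg_pos hε hαβ hA ⟨by linarith [ha.1], ha.2⟩
      ⟨hb.1, by linarith [hb.2]⟩ ha0 hb0 (mul_neg_of_pos_of_neg had hbd)

/-- Every vertex gives rise to a local family of fixed points. -/
theorem exists_family_of_isLocalExtr (F : BoundaryFrame S L γ T ν κ) {s : ℝ}
    (hs : IsLocalExtr κ s) {ε : ℝ} (hε : 0 < ε) :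
    ∃ C, IsLocalFixedFamily S (thickening ε (flatPiece S (γ s))) C := by
  have hself : γ s ∈ flatPiece S (γ s) := by
    show segment ℝ (γ s) (γ s) ⊆ frontier S
    rw [segment_same, singleton_subset_iff]
    exact F.curve_mem_frontier s
  by_cases hκ : κ s = 0
  -- Zero is the global lower bound of the curvature, so the ends of the flat arc through `s` are
  -- left upwards on both sides.
  · obtain ⟨β, hsβ, hβ, hβr⟩ := F.exists_right_end hκ
    obtain ⟨α', hsα, hα, hαr⟩ := F.reverse.exists_right_end (s := -s) (by simpa using hκ)
    have hα' : ∀ u ∈ Icc (-α') s, κ u = 0 := fun u hu => by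
      simpa using hα (-u) ⟨by linarith [hu.2], by linarith [hu.1]⟩
    have hαs : -α' ≤ s := by linarith
    refine F.exists_family_of_ends (α := -α') (β := β) (k := 0) hε one_pos (by linarith) ?_
      (hα' _ ⟨le_rfl, hαs⟩) (hβ _ ⟨hsβ, le_rfl⟩) ?_ hβr (Or.inl fun u _ => F.curv_nonneg u)
    · intro u hu
      refine F.mem_flatPiece_of_curv_eq_zero fun v hv => ?_
      rcases le_total v s with h | h
      · refine hα' v ⟨?_, h⟩
        exact (le_inf hαs hu.1).trans hv.1
      · exact hβ v ⟨h, hv.2.trans (sup_le hsβ hu.2)⟩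
    · intro η hη
      obtain ⟨b, hb, hb0⟩ := hαr η hη
      exact ⟨-b, ⟨by linarith [hb.2], by linarith [hb.1]⟩, hb0⟩
  · by_cases harc : ∃ u η, |u - s| < ε / 2 ∧ 0 < η ∧ ∀ v ∈ Ioo (u - η) (u + η), κ v = κ s
    · obtain ⟨u, η, hu, hη, hv⟩ := harc
      exact F.exists_family_of_const_curv hself hu hε hκ hη hv
    · push Not at harc
      have hend : ∀ η > 0, ∃ r > 0, r ≤ η / 2 ∧ r < ε / 2 := fun η hη => by
        refine ⟨min (η / 2) (ε / 4), lt_min (by linarith) (by linarith), min_le_left _ _, ?_⟩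
        exact (min_le_right _ _).trans_lt (by linarith)
      have hev : ∃ η > 0, (∀ u ∈ Ioo (s - η) s ∪ Ioo s (s + η), κ s ≤ κ u) ∨
          ∀ u ∈ Ioo (s - η) s ∪ Ioo s (s + η), κ u ≤ κ s := by
        rcases hs with h | h
        all_goals
          obtain ⟨r, hr, hball⟩ := Metric.eventually_nhds_iff.1 h
          have hall : ∀ u ∈ Ioo (s - r) s ∪ Ioo s (s + r), dist u s < r := by
            rintro u (hu | hu) <;> rw [Real.dist_eq, abs_lt] <;>
              exact ⟨by linarith [hu.1], by linarith [hu.2]⟩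
        · exact ⟨r, hr, Or.inl fun u hu => hball (hall u hu)⟩
        · exact ⟨r, hr, Or.inr fun u hu => hball (hall u hu)⟩
      obtain ⟨η₀, hη₀, hext⟩ := hev
      refine F.exists_family_of_ends (α := s) (β := s) hε hη₀ le_rfl ?_ rfl rfl ?_ ?_ hext
      · intro u hu
        rw [le_antisymm hu.2 hu.1]
        exact hself
      · intro η hη
        obtain ⟨r, hr, hrη, hrε⟩ := hend η hη
        -- The window of radius `r` around `s - r` is `(s - 2 * r, s)`, entirely to the left of `s`.
        obtain ⟨v, hv, hvκ⟩ := harc (s - r) r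
          (by rw [sub_sub_cancel_left, abs_neg, abs_of_pos hr]; exact hrε) hr
        exact ⟨v, ⟨by linarith [hv.1], by linarith [hv.2]⟩, hvκ⟩
      · intro η hη
        obtain ⟨r, hr, hrη, hrε⟩ := hend η hη
        obtain ⟨v, hv, hvκ⟩ := harc (s + r) r
          (by rw [add_sub_cancel_left, abs_of_pos hr]; exact hrε) hr
        exact ⟨v, ⟨by linarith [hv.1], by linarith [hv.2]⟩, hvκ⟩

/-- Families near disjoint flat pieces can be chosen pairwise disjoint. -/
theorem exists_disjoint_families (F : BoundaryFrame S L γ T ν κ) {ι : Type*} [Finite ι] {s : ι → ℝ}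
    (hs : ∀ i, IsLocalExtr κ (s i))
    (hdisj : ∀ i j, i ≠ j → Disjoint (flatPiece S (γ (s i))) (flatPiece S (γ (s j)))) {ε : ℝ}
    (hε : 0 < ε) : ∃ C : ι → Set (Plane × Plane),
      (∀ i, IsLocalFixedFamily S (thickening ε (flatPiece S (γ (s i)))) (C i)) ∧
      ∀ i j, i ≠ j → Disjoint (C i) (C j) := by
  have hsep : ∀ᶠ r in nhdsWithin (0 : ℝ) (Ioi 0), ∀ i j, i ≠ j →
      Disjoint (thickening r (flatPiece S (γ (s i)))) (thickening r (flatPiece S (γ (s j)))) := by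
    refine Filter.eventually_all.2 fun i => Filter.eventually_all.2 fun j => ?_
    by_cases hij : i = j
    · exact Filter.Eventually.of_forall fun r h => absurd hij h
    · obtain ⟨δ, hδ, hd⟩ := (hdisj i j hij).exists_thickenings
        (isCompact_flatPiece F.compact _) (isCompact_flatPiece F.compact _).isClosed
      filter_upwards [Ioo_mem_nhdsGT hδ] with r hr _
      exact hd.mono (thickening_mono hr.2.le _) (thickening_mono hr.2.le _)
  -- Families built in thickenings of a smaller radius `r` are disjoint because their base points
  -- lie in disjoint regions.
  obtain ⟨r, hr, hrε⟩ := (hsep.and (Ioo_mem_nhdsGT hε)).exists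
  choose C hC using fun i => F.exists_family_of_isLocalExtr (hs i) hrε.1
  refine ⟨C, fun i => (hC i).mono (thickening_mono hrε.2.le _), fun i j hij => ?_⟩
  rw [Set.disjoint_left]
  intro z hzi hzj
  exact Set.disjoint_left.1 (hr i j hij) ((hC i).2.1 z hzi) ((hC j).2.1 z hzj)

end BoundaryFrame
end

theorem theorem2p1 (S : Set Plane) (hconv : Convex ℝ S) (hcomp : IsCompact S)
    (hint : (interior S).Nonempty) (L : ℝ) (γ : ℝ → Plane) (hγ : IsArcLengthBoundary S L γ) :
    -- there are uncountably many fixed points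
    ¬ (exteriorFixedPoints S).Countable ∧
    -- a local one-parameter family of fixed points arises near every vertex
    (∀ s : ℝ, IsVertex γ s → ∀ ε : ℝ, 0 < ε →
      ∃ C : Set (Plane × Plane),
        IsLocalFixedFamily S (Metric.thickening ε (flatPiece S (γ s))) C) ∧
    -- there are at least four vertices, and they give four different families
    ∃ s : Fin 4 → ℝ, (∀ i, IsVertex γ (s i)) ∧
      (∀ i j, i ≠ j → Disjoint (flatPiece S (γ (s i))) (flatPiece S (γ (s j)))) ∧
      ∀ ε : ℝ, 0 < ε → ∃ C : Fin 4 → Set (Plane × Plane),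
        (∀ i, IsLocalFixedFamily S (Metric.thickening ε (flatPiece S (γ (s i)))) (C i)) ∧
        ∀ i j, i ≠ j → Disjoint (C i) (C j) := by
  obtain ⟨T, ν, κ, F⟩ := exists_boundaryFrame hconv hcomp hint hγ
  simp only [IsVertex, F.curvature_eq]
  obtain ⟨s, hs, hdisj⟩ := F.exists_four_extrema
  refine ⟨?_, fun s hs ε hε => F.exists_family_of_isLocalExtr hs hε, s, hs, hdisj,
    fun ε hε => F.exists_disjoint_families hs hdisj hε⟩
  obtain ⟨C, hC⟩ := F.exists_family_of_isLocalExtr (hs 0) one_pos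
  exact hC.not_countable
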